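/- **Modularity of confluence for Constraint Handling Rules (CHR).** *Setting.* Fix a first-order signature $L$, a first-order theory $\mathcal{CT}$ over $L$, a language of built-in constraints (a class of $L$-formulas over a countably infinite set of variables that contains all equations between terms, $\top$ and $\bot$, and is closed under conjunction and renaming of variables), and a set of user-defined predicate symbols with arities. Atoms are $p(t_1,\dots,t_n)$ with $p$ user-defined and $t_i$ $L$-terms; for atoms $c,d$, the constraint $c=d$ is the conjunction of the equations between corresponding arguments if $c,d$ have the same predicate symbol, and $\bot$ otherwise. *Programs.* A CHR rule $r\,@\,K\backslash H\Leftrightarrow G\mid B;C$ consists of a name $r$, multisets of atoms $K$ (kept head), $H$ (removed head), $B$ (user body) with $K,H$ not both empty, and constraints $G$ (guard), $C$ (built-in body). Its local variables $\mathrm{lv}(r)$ are those that do not occur in $K,H$. A program is a finite set of rules with pairwise distinct names. *States.* A state $\langle E;C;\bar x\rangle$ consists of a multiset $E$ of atoms, a constraint $C$, and a finite set $\bar x$ of (global) variables. States are considered modulo the least equivalence relation $\equiv$ such that - $\langle E;C;\bar x\rangle\equiv\langle E;D;\bar x\rangle$ if $\mathcal{CT}\models\exists_{-(E,\bar x)}C\leftrightarrow\exists_{-(E,\bar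 x)}D$, where $\exists_{-(E,\bar x)}$ is existential closure with the exception of the variables of $E$ and $\bar x$; - $\langle E;\bot;\bar x\rangle\equiv\langle F;\bot;\bar y\rangle$; - $\langle A,c;\,C\wedge c=d;\,\bar x\rangle\equiv\langle A,d;\,C\wedge c=d;\,\bar x\rangle$; - $\langle A;C;\bar x\rangle\equiv\langle A;C;\{y\}\cup\bar x\rangle$ if $y\notin\mathrm{fv}(A,C)$. *Transitions.* For a set $P$ of rules, $\to_P$ is the relation on states modulo $\equiv$ given by $$\langle K,H,E;\;G\wedge D;\;\bar x\rangle\to_P\langle K,B,E;\;G\wedge C\wedge D;\;\bar x\rangle$$ whenever $(r\,@\,K\backslash H\Leftrightarrow G\mid B;C)$ is a renaming of a rule of $P$ and $\mathrm{lv}(r)\cap\mathrm{fv}(E,D,\bar x)=\emptyset$. Write $\twoheadrightarrow_P$ for its reflexive-transitive closure and $\to_P^{=}$ for its reflexive closure. $P$ is confluent if, whenever $s\twoheadrightarrow_P s_1$ and $s\twoheadrightarrow_P s_2$, there is $t$ with $s_1\twoheadrightarrow_P t$ and $s_2\twoheadrightarrow_P t$. *Critical peaks.* Let $r_i\,@\,K_i\backslash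 H_i\Leftrightarrow G_i\mid B_i;C_i$ ($i=1,2$) be renamings, without common variables, of a rule of $P$ and of a rule of $Q$ respectively. Let $(K_i,H_i)=(\Delta_i,I_i)$ as multisets, where $I_1,I_2$ are non-empty and enumerated as sequences of the same length, and let $I_1=I_2$ stand for the conjunction of the componentwise equations of atoms. Put $D=(I_1=I_2)\wedge G_1\wedge G_2$ and $\bar x=\mathrm{fv}(K_1,H_1)\cup\mathrm{fv}(K_2,H_2)$. Suppose that $\exists D$ holds in some model of $\mathcal{CT}$, and that $I_1\not\subseteq K_1$ or $I_2\not\subseteq K_2$ as multisets. Then $$\langle K_1,B_1,\Delta_2;\,D\wedge C_1;\,\bar x\rangle\;\leftarrow\;\langle\Delta_1,I_1,\Delta_2;\,D;\,\bar x\rangle\;\to\;\langle K_2,B_2,\Delta_1;\,D\wedge C_2;\,\bar x\rangle$$ is a critical peak between $P$ and $Q$. **Theorem.** Let $P$ and $Q$ be two confluent CHR programs. Suppose that every critical peak $S_1\leftarrow S_c\to S_2$ between $P$ and $Q$ is joinable by $\twoheadrightarrow_Q\cdot\leftarrow_P^{=}$, that is, there is a state $t$ with $S_1\twoheadrightarrow_Q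 t$ and $S_2\to_P^{=}t$. Then the union $P\cup Q$ is confluent. (Neither program nor the union is assumed to be terminating.) -/

import Mathlib

/-!
Constraint Handling Rules (CHR): programs, states modulo structural equivalence, the
equivalence-based operational semantics, and critical peaks.  Variables are the natural numbers.
-/

namespace CHR

universe u v w

/-- A language of built-in constraints over the first-order signature `L`: a class of formulas
that contains all equations, `⊤` and `⊥`, and is closed under conjunction and renaming.
It may be, for instance, all first-order formulas, or all conjunctions of atomic formulas. -/
structure ConstraintLanguage (L : FirstOrder.Language.{u, v}) where
  carrier : Set (L.Formula ℕ)
  equal_mem : ∀ s t : L.Term ℕ, s.equal t ∈ carrier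
  top_mem : (⊤ : L.Formula ℕ) ∈ carrier
  bot_mem : (⊥ : L.Formula ℕ) ∈ carrier
  inf_mem : ∀ {φ ψ : L.Formula ℕ}, φ ∈ carrier → ψ ∈ carrier → φ ⊓ ψ ∈ carrier
  relabel_mem : ∀ (ρ : Equiv.Perm ℕ) {φ : L.Formula ℕ}, φ ∈ carrier → φ.relabel ρ ∈ carrier

variable {L : FirstOrder.Language.{u, v}}

/-- A (conjunction of) built-in constraints. -/
def Constraint (𝓒 : ConstraintLanguage L) : Type (max u v) :=
  {φ : L.Formula ℕ // φ ∈ 𝓒.carrier}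

namespace Constraint

variable {𝓒 : ConstraintLanguage L}

instance : Top (Constraint 𝓒) := ⟨⟨⊤, 𝓒.top_mem⟩⟩

instance : Bot (Constraint 𝓒) := ⟨⟨⊥, 𝓒.bot_mem⟩⟩

/-- Conjunction. -/
instance : Min (Constraint 𝓒) := ⟨fun C D => ⟨C.1 ⊓ D.1, 𝓒.inf_mem C.2 D.2⟩⟩

/-- The equation `s = t`. -/
def eqTerm (s t : L.Term ℕ) : Constraint 𝓒 := ⟨s.equal t, 𝓒.equal_mem s t⟩

/-- The free variables of a constraint. -/
def fv (C : Constraint 𝓒) : Finset ℕ := C.1.freeVarFinset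

/-- Renaming of the variables. -/
def rename (ρ : Equiv.Perm ℕ) (C : Constraint 𝓒) : Constraint 𝓒 :=
  ⟨C.1.relabel ρ, 𝓒.relabel_mem ρ C.2⟩

/-- The finite conjunction of a list of constraints. -/
def conj (l : List (Constraint 𝓒)) : Constraint 𝓒 := l.foldr (· ⊓ ·) ⊤

/-- `C` is satisfiable with respect to `CT`: some model of `CT` satisfies the existential closure
of `C`. -/
def Satisfiable (CT : L.Theory) (C : Constraint 𝓒) : Prop :=
  ∃ (M : FirstOrder.Language.Theory.ModelType.{u, v, max u v} CT) (e : ℕ → M), C.1.Realize e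

/-- `CT ⊨ ∀ (∃₋X C ↔ ∃₋X D)`, where `∃₋X φ` is the existential closure of `φ` with the exception
of the variables in `X`. -/
def EquivOver (CT : L.Theory) (X : Finset ℕ) (C D : Constraint 𝓒) : Prop :=
  ∀ (M : FirstOrder.Language.Theory.ModelType.{u, v, max u v} CT) (e : ℕ → M),
    (∃ e' : ℕ → M, (∀ i ∈ X, e' i = e i) ∧ C.1.Realize e') ↔
      (∃ e' : ℕ → M, (∀ i ∈ X, e' i = e i) ∧ D.1.Realize e')

end Constraint

/-- User-defined atoms `p(t₁, …, tₙ)`; the predicate symbols `p : Pred` are distinct from the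
built-in ones. -/
structure Atom (L : FirstOrder.Language.{u, v}) {Pred : Type w} (arity : Pred → ℕ) where
  pred : Pred
  args : Fin (arity pred) → L.Term ℕ

variable {Pred : Type w} {arity : Pred → ℕ}

namespace Atom

/-- The free variables of an atom. -/
def fv (a : Atom L arity) : Finset ℕ := Finset.univ.biUnion fun i => (a.args i).varFinset

/-- Renaming of the variables. -/
def rename (ρ : Equiv.Perm ℕ) (a : Atom L arity) : Atom L arity :=
  ⟨a.pred, fun i => (a.args i).relabel ρ⟩

open Classical in
/-- The equation `c = d` between two atoms: the conjunction of the equations between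
corresponding arguments if both have the same predicate symbol, and `⊥` otherwise. -/
noncomputable def eqAtom {𝓒 : ConstraintLanguage L} (c d : Atom L arity) : Constraint 𝓒 :=
  if c.pred = d.pred then
    Constraint.conj (List.zipWith Constraint.eqTerm (List.ofFn c.args) (List.ofFn d.args))
  else ⊥

end Atom

/-- The free variables of a multiset of atoms. -/
def fvs (A : Multiset (Atom L arity)) : Finset ℕ := (A.map Atom.fv).sup

/-- The equation between two sequences of atoms of the same length, componentwise. -/
noncomputable def eqAtoms {𝓒 : ConstraintLanguage L} (I J : List (Atom L arity)) : Constraint 𝓒 :=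
  Constraint.conj (List.zipWith Atom.eqAtom I J)

/-! ### States -/

/-- A CHR state (before passing to the quotient): user store, built-in store, and global
variables. -/
structure State (𝓒 : ConstraintLanguage L) (arity : Pred → ℕ) where
  user : Multiset (Atom L arity)
  builtin : Constraint 𝓒
  globals : Finset ℕ

variable {𝓒 : ConstraintLanguage L}

/-- The generating rules of the state equivalence. -/
inductive BasicEquiv (CT : L.Theory) : State 𝓒 arity → State 𝓒 arity → Prop
  | transformation (E : Multiset (Atom L arity)) (C D : Constraint 𝓒) (x : Finset ℕ)
      (h : Constraint.EquivOver CT (fvs E ∪ x) C D) :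
      BasicEquiv CT ⟨E, C, x⟩ ⟨E, D, x⟩
  | inconsistent (E F : Multiset (Atom L arity)) (x y : Finset ℕ) :
      BasicEquiv CT ⟨E, ⊥, x⟩ ⟨F, ⊥, y⟩
  | equality (A : Multiset (Atom L arity)) (c d : Atom L arity) (C : Constraint 𝓒)
      (x : Finset ℕ) :
      BasicEquiv CT ⟨A + {c}, C ⊓ c.eqAtom d, x⟩ ⟨A + {d}, C ⊓ c.eqAtom d, x⟩
  | omission (A : Multiset (Atom L arity)) (C : Constraint 𝓒) (x : Finset ℕ) (y : ℕ)
      (h : y ∉ fvs A ∪ C.fv) :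
      BasicEquiv CT ⟨A, C, x⟩ ⟨A, C, {y} ∪ x⟩

/-- The state equivalence: the least equivalence relation that contains the generating rules. -/
def stateSetoid (CT : L.Theory) (𝓒 : ConstraintLanguage L) (arity : Pred → ℕ) :
    Setoid (State 𝓒 arity) :=
  Relation.EqvGen.setoid (BasicEquiv CT)

/-- States modulo equivalence. -/
abbrev StateClass (CT : L.Theory) (𝓒 : ConstraintLanguage L) (arity : Pred → ℕ) :
    Type (max u v w) :=
  Quotient (stateSetoid CT 𝓒 arity)

/-- The class of a state. -/
def State.toClass (CT : L.Theory) (S : State 𝓒 arity) : StateClass CT 𝓒 arity :=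
  Quotient.mk (stateSetoid CT 𝓒 arity) S

/-! ### Programs -/

/-- A CHR rule `name @ kept \ removed ⟺ guard | body; builtinBody`. -/
structure Rule (𝓡 : Type*) (𝓒 : ConstraintLanguage L) (arity : Pred → ℕ) where
  name : 𝓡
  kept : Multiset (Atom L arity)
  removed : Multiset (Atom L arity)
  guard : Constraint 𝓒
  body : Multiset (Atom L arity)
  builtinBody : Constraint 𝓒
  head_ne : kept + removed ≠ 0

variable {𝓡 : Type*}

namespace Rule

/-- The variables of the heads. -/
def headVars (r : Rule 𝓡 𝓒 arity) : Finset ℕ := fvs (r.kept + r.removed)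

/-- All variables of the rule. -/
def fv (r : Rule 𝓡 𝓒 arity) : Finset ℕ :=
  r.headVars ∪ r.guard.fv ∪ fvs r.body ∪ r.builtinBody.fv

/-- The local variables of the rule: those that do not occur in the heads. -/
def lv (r : Rule 𝓡 𝓒 arity) : Finset ℕ := r.fv \ r.headVars

/-- Renaming of the variables of a rule. -/
def rename (ρ : Equiv.Perm ℕ) (r : Rule 𝓡 𝓒 arity) : Rule 𝓡 𝓒 arity where
  name := r.name
  kept := r.kept.map (Atom.rename ρ)
  removed := r.removed.map (Atom.rename ρ)
  guard := r.guard.rename ρ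
  body := r.body.map (Atom.rename ρ)
  builtinBody := r.builtinBody.rename ρ
  head_ne := by
    intro h
    rw [← Multiset.map_add, Multiset.map_eq_zero] at h
    exact r.head_ne h

end Rule

/-- A CHR program: a finite set of rules in which rule names are unique. -/
def IsProgram (P : Set (Rule 𝓡 𝓒 arity)) : Prop :=
  P.Finite ∧ Set.InjOn Rule.name P

/-- One transition of a set of rules, on states modulo equivalence. -/
inductive Step (CT : L.Theory) (P : Set (Rule 𝓡 𝓒 arity)) :
    StateClass CT 𝓒 arity → StateClass CT 𝓒 arity → Prop
  | mk (r₀ r : Rule 𝓡 𝓒 arity) (ρ : Equiv.Perm ℕ) (hr₀ : r₀ ∈ P) (hr : r = r₀.rename ρ)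
      (E : Multiset (Atom L arity)) (D : Constraint 𝓒) (x : Finset ℕ)
      (hlv : Disjoint r.lv (fvs E ∪ D.fv ∪ x)) :
      Step CT P
        (State.toClass CT ⟨r.kept + r.removed + E, r.guard ⊓ D, x⟩)
        (State.toClass CT ⟨r.kept + r.body + E, r.guard ⊓ r.builtinBody ⊓ D, x⟩)

/-- Reflexive-transitive closure of the transition relation. -/
def Steps (CT : L.Theory) (P : Set (Rule 𝓡 𝓒 arity)) :
    StateClass CT 𝓒 arity → StateClass CT 𝓒 arity → Prop :=
  Relation.ReflTransGen (Step CT P)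

/-- Reflexive closure of the transition relation. -/
def StepEq (CT : L.Theory) (P : Set (Rule 𝓡 𝓒 arity)) :
    StateClass CT 𝓒 arity → StateClass CT 𝓒 arity → Prop :=
  Relation.ReflGen (Step CT P)

/-- Confluence. -/
def Confluent (CT : L.Theory) (P : Set (Rule 𝓡 𝓒 arity)) : Prop :=
  ∀ s s₁ s₂ : StateClass CT 𝓒 arity, Steps CT P s s₁ → Steps CT P s s₂ →
    ∃ t, Steps CT P s₁ t ∧ Steps CT P s₂ t

/-! ### Critical peaks -/

/-- `RuleCriticalPeak CT r₁ r₂ S₁ Sc S₂`: the tuple `S₁ ← Sc → S₂` is a critical peak between the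
rules `r₁` and `r₂`, which have no variable in common, at the critical ancestor `Sc`.
Here `I₁`, `I₂` are the overlapping parts of the heads, listed so that the `i`-th atom of `I₁` is
identified with the `i`-th atom of `I₂`, and `Δ₁`, `Δ₂` are the remaining parts of the heads. -/
inductive RuleCriticalPeak (CT : L.Theory) (r₁ r₂ : Rule 𝓡 𝓒 arity) :
    State 𝓒 arity → State 𝓒 arity → State 𝓒 arity → Prop
  | mk (Δ₁ Δ₂ : Multiset (Atom L arity)) (I₁ I₂ : List (Atom L arity))
      (D : Constraint 𝓒) (x : Finset ℕ)
      (apart : Disjoint r₁.fv r₂.fv)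
      (split₁ : r₁.kept + r₁.removed = Δ₁ + (I₁ : Multiset (Atom L arity)))
      (split₂ : r₂.kept + r₂.removed = Δ₂ + (I₂ : Multiset (Atom L arity)))
      (ne₁ : I₁ ≠ []) (ne₂ : I₂ ≠ []) (length_eq : I₁.length = I₂.length)
      (hx : x = r₁.headVars ∪ r₂.headVars)
      (hD : D = eqAtoms I₁ I₂ ⊓ r₁.guard ⊓ r₂.guard)
      (sat : D.Satisfiable CT)
      (notKept : ¬ (I₁ : Multiset (Atom L arity)) ≤ r₁.kept ∨
        ¬ (I₂ : Multiset (Atom L arity)) ≤ r₂.kept) :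
      RuleCriticalPeak CT r₁ r₂
        ⟨r₁.kept + r₁.body + Δ₂, D ⊓ r₁.builtinBody, x⟩
        ⟨Δ₁ + (I₁ : Multiset (Atom L arity)) + Δ₂, D, x⟩
        ⟨r₂.kept + r₂.body + Δ₁, D ⊓ r₂.builtinBody, x⟩

/-- Critical peaks between two programs: those between a (renamed) rule of the first and a
(renamed) rule of the second. -/
def CriticalPeak (CT : L.Theory) (P Q : Set (Rule 𝓡 𝓒 arity)) (S₁ Sc S₂ : State 𝓒 arity) : Prop :=
  ∃ r₁ ∈ P, ∃ r₂ ∈ Q, ∃ ρ₁ ρ₂ : Equiv.Perm ℕ,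
    RuleCriticalPeak CT (r₁.rename ρ₁) (r₂.rename ρ₂) S₁ Sc S₂

end CHR

open FirstOrder
universe u v w

/-! The theorem is reduced to strong commutation of the two transition relations: if a `P`-step and
a `Q`-step leave the same state, the first result reaches a common state by `Q`-steps and the second
by at most one `P`-step (`exists_join_of_step_of_step`). Strongly commuting relations commute, and
by the Hindley–Rosen argument the union of two commuting confluent relations is confluent.
Termination plays no role.

For strong commutation, present the common state once as the source of each rule, without common
variables between the rules and with only global variables shared between the presentations. If the
state is inconsistent, so are both results, and they are equal. Otherwise the atoms of the two
presentations correspond position by position, and both built-in stores together with the equations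
between corresponding atoms can be assumed in either result (`SameOutcomes.exists_mergedPeak`).
Intersecting the positions of the two heads gives the overlap. If it is kept by both rules, neither
disables the other, and each is applied after the other. If not, the two steps are an instance of a
critical peak in a larger context, and its joining transitions are carried over to that context
(`Steps.inContext`, `StepEq.inContext`).

All this needs control over states modulo equivalence, which is obtained semantically. The invariant
`SameOutcomes` records, for one fixed listing of the atoms and every model, which values the atoms
can take for given values of the global variables; equivalent states are both inconsistent or agree
in it (`sameOutcomes_of_toClass_eq`). Conversely, states whose solutions match are equivalent
(`toClass_eq_of_hasMatch`). Hence equivalence is preserved by contexts that capture no local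
variables (`toClass_inContext`). -/

theorem Equiv.sumCongr_refl_coe {α β γ : Type*} (g : α ≃ β) :
    (g.sumCongr (Equiv.refl γ) : α ⊕ γ → β ⊕ γ) = Sum.map g id := rfl

/-! ### Renaming of variables in first-order terms and formulas. -/

namespace FirstOrder.Language

variable {L : Language.{u, v}} {α β γ : Type*}

theorem Term.mem_varFinset_relabel [DecidableEq α] [DecidableEq β] (g : α ≃ β) (t : L.Term α)
    (b : β) : b ∈ (t.relabel g).varFinset ↔ g.symm b ∈ t.varFinset := by
  induction t with
  | var a => simp [Term.relabel, Equiv.symm_apply_eq]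
  | func f ts ih => simp [Term.relabel, ih]

theorem Term.mem_varFinsetLeft_relabel [DecidableEq α] [DecidableEq β] (g : α ≃ β)
    (h : γ → γ) (t : L.Term (α ⊕ γ)) (b : β) :
    b ∈ (t.relabel (Sum.map g h)).varFinsetLeft ↔ g.symm b ∈ t.varFinsetLeft := by
  induction t with
  | var a => rcases a with a | a <;> simp [Term.relabel, Equiv.symm_apply_eq]
  | func f ts ih => simp [Term.relabel, ih]

theorem Term.varFinsetLeft_relabel_inl [DecidableEq α] (t : L.Term α) :
    (t.relabel (Sum.inl : α → α ⊕ γ)).varFinsetLeft = t.varFinset := by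
  induction t with
  | var a => simp [Term.relabel]
  | func f ts ih => simp [Term.relabel, ih]

theorem Term.realize_congr {M : Type*} [L.Structure M] [DecidableEq α] (t : L.Term α)
    {e e' : α → M} (h : ∀ i ∈ t.varFinset, e i = e' i) : t.realize e = t.realize e' := by
  induction t with
  | var a => exact h a (by simp)
  | func f ts ih =>
    simp only [Term.realize_func]
    congr 1
    funext i
    exact ih i fun j hj => h j (by simpa using ⟨i, hj⟩)

namespace BoundedFormula

/-- `Formula.relabel` is built on `BoundedFormula.relabel`, which may also bind variables and so
shifts indices. Splitting off `g` leaves a relabelling by `Sum.inl`, which is trivial for formulas;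
`relabelEquiv` is a plain structural recursion, on which free variables and composition are easy to
compute. -/
theorem relabel_inl_comp (g : α ≃ β) {k n : ℕ} (φ : L.BoundedFormula α k) :
    (φ.relabel (Sum.inl ∘ g : α → β ⊕ Fin n) : L.BoundedFormula β (n + k)) =
      (relabelEquiv g φ).relabel (Sum.inl : β → β ⊕ Fin n) := by
  have key : ∀ k, (relabelAux (Sum.inl ∘ g : α → β ⊕ Fin n) k) =
      relabelAux (Sum.inl : β → β ⊕ Fin n) k ∘ Sum.map g id := by
    intro k
    funext i
    rcases i with i | i <;> simp [relabelAux]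
  induction φ with
  | falsum => rfl
  | equal t₁ t₂ =>
    simp [relabel, relabelEquiv, mapTermRel, mapTermRelEquiv, key, Equiv.sumCongr_refl_coe,
      Sum.map_comp_map]
  | rel R ts =>
    simp [relabel, relabelEquiv, mapTermRel, mapTermRelEquiv, key, Equiv.sumCongr_refl_coe,
      Sum.map_comp_map]
  | imp _ _ ih1 ih2 =>
    simp only [relabel, relabelEquiv, mapTermRel, mapTermRelEquiv, Equiv.coe_fn_mk] at ih1 ih2 ⊢
    rw [ih1, ih2]
  | all _ ih =>
    simp only [relabel, relabelEquiv, mapTermRel, mapTermRelEquiv, Equiv.coe_fn_mk, id] at ih ⊢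
    rw [ih]

theorem mem_freeVarFinset_relabelEquiv [DecidableEq α] [DecidableEq β] (g : α ≃ β) {k : ℕ}
    (φ : L.BoundedFormula α k) (b : β) :
    b ∈ (relabelEquiv g φ).freeVarFinset ↔ g.symm b ∈ φ.freeVarFinset := by
  induction φ with
  | falsum => simp [relabelEquiv, mapTermRel, mapTermRelEquiv]
  | equal t₁ t₂ =>
    simp [relabelEquiv, mapTermRel, mapTermRelEquiv, Equiv.sumCongr_refl_coe,
      Term.mem_varFinsetLeft_relabel]
  | rel R ts =>
    simp [relabelEquiv, mapTermRel, mapTermRelEquiv, Equiv.sumCongr_refl_coe,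
      Term.mem_varFinsetLeft_relabel]
  | imp _ _ ih1 ih2 =>
    simp only [relabelEquiv, mapTermRel, mapTermRelEquiv, Equiv.coe_fn_mk, freeVarFinset,
      Finset.mem_union] at ih1 ih2 ⊢
    rw [ih1, ih2]
  | all _ ih =>
    simp only [relabelEquiv, mapTermRel, mapTermRelEquiv, Equiv.coe_fn_mk, freeVarFinset,
      id] at ih ⊢
    rw [ih]

theorem realize_congr {M : Type*} [L.Structure M] [DecidableEq α] {k : ℕ}
    (φ : L.BoundedFormula α k) {e e' : α → M} {xs : Fin k → M}
    (h : ∀ i ∈ φ.freeVarFinset, e i = e' i) : φ.Realize e xs ↔ φ.Realize e' xs := by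
  have h1 := φ.realize_restrictFreeVar' (s := {i | i ∈ φ.freeVarFinset}) (fun i hi => hi)
    (v := e) (xs := xs)
  have h2 := φ.realize_restrictFreeVar' (s := {i | i ∈ φ.freeVarFinset}) (fun i hi => hi)
    (v := e') (xs := xs)
  rw [← h1, ← h2]
  have : (e ∘ (↑) : {i | i ∈ φ.freeVarFinset} → M) = e' ∘ (↑) := by
    funext i
    exact h i.1 i.2
  rw [this]

end BoundedFormula

namespace Formula

theorem relabel_eq_relabelEquiv (g : α ≃ β) (φ : L.Formula α) :
    φ.relabel g = BoundedFormula.relabelEquiv g φ := by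
  unfold Formula.relabel
  rw [BoundedFormula.relabel_inl_comp, BoundedFormula.relabel_sumInl]
  exact BoundedFormula.castLE_rfl _ _

theorem mem_freeVarFinset_relabel [DecidableEq α] [DecidableEq β] (g : α ≃ β) (φ : L.Formula α)
    (b : β) : b ∈ (φ.relabel g).freeVarFinset ↔ g.symm b ∈ φ.freeVarFinset := by
  rw [relabel_eq_relabelEquiv]
  exact BoundedFormula.mem_freeVarFinset_relabelEquiv g φ b

theorem relabel_relabel (g : α ≃ β) (h : β ≃ γ) (φ : L.Formula α) :
    (φ.relabel g).relabel h = φ.relabel (g.trans h) := by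
  simp only [relabel_eq_relabelEquiv, BoundedFormula.relabelEquiv,
    BoundedFormula.mapTermRelEquiv, Equiv.coe_fn_mk]
  rw [BoundedFormula.mapTermRel_mapTermRel]
  congr 1
  funext n t
  simp [Equiv.sumCongr_refl_coe, Sum.map_comp_map]

theorem relabel_refl (φ : L.Formula α) : φ.relabel (_root_.Equiv.refl α) = φ := by
  rw [relabel_eq_relabelEquiv]
  have : (fun n => Term.relabel (L := L) (Sum.map (_root_.Equiv.refl α) (id : Fin n → Fin n))) =
      fun _ => id := by
    funext n t
    simp [Term.relabel_id]
  change BoundedFormula.mapTermRel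
    (fun n => Term.relabel (L := L) (Sum.map (_root_.Equiv.refl α) (id : Fin n → Fin n)))
    (fun _ => id) (fun _ => id) φ = φ
  rw [this]
  exact BoundedFormula.mapTermRel_id_id_id φ

end Formula

end FirstOrder.Language

/-! ### Semantics, free variables and renaming of constraints, atoms and rules. -/

namespace CHR

variable {L : FirstOrder.Language.{u, v}} {𝓒 : ConstraintLanguage L} {Pred : Type w}
  {arity : Pred → ℕ} {M : Type*} [L.Structure M]

namespace Constraint

@[simp]
theorem realize_inf (C D : Constraint 𝓒) (e : ℕ → M) :
    (C ⊓ D).1.Realize e ↔ C.1.Realize e ∧ D.1.Realize e :=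
  Language.Formula.realize_inf

@[simp]
theorem realize_bot (e : ℕ → M) : ¬ (⊥ : Constraint 𝓒).1.Realize e :=
  fun h => h

@[simp]
theorem realize_top (e : ℕ → M) : (⊤ : Constraint 𝓒).1.Realize e :=
  Language.Formula.realize_top.2 trivial

@[simp]
theorem mem_fv_inf (C D : Constraint 𝓒) (i : ℕ) : i ∈ (C ⊓ D).fv ↔ i ∈ C.fv ∨ i ∈ D.fv := by
  have : (C ⊓ D).fv = ((C.1.imp (D.1.imp ⊥)).imp ⊥).freeVarFinset := rfl
  rw [this]
  simp [fv, Language.BoundedFormula.freeVarFinset]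

@[simp]
theorem fv_top : (⊤ : Constraint 𝓒).fv = ∅ := rfl

@[simp]
theorem fv_bot : (⊥ : Constraint 𝓒).fv = ∅ := rfl

@[simp]
theorem mem_fv_rename (ρ : Equiv.Perm ℕ) (C : Constraint 𝓒) (i : ℕ) :
    i ∈ (C.rename ρ).fv ↔ ρ.symm i ∈ C.fv :=
  Language.Formula.mem_freeVarFinset_relabel ρ C.1 i

@[simp]
theorem realize_rename (ρ : Equiv.Perm ℕ) (C : Constraint 𝓒) (e : ℕ → M) :
    (C.rename ρ).1.Realize e ↔ C.1.Realize (e ∘ ρ) :=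
  Language.Formula.realize_relabel

theorem rename_rename (ρ τ : Equiv.Perm ℕ) (C : Constraint 𝓒) :
    (C.rename ρ).rename τ = C.rename (ρ.trans τ) :=
  Subtype.ext (Language.Formula.relabel_relabel ρ τ C.1)

theorem rename_refl (C : Constraint 𝓒) : C.rename (Equiv.refl ℕ) = C :=
  Subtype.ext (Language.Formula.relabel_refl C.1)

theorem rename_inf (ρ : Equiv.Perm ℕ) (C D : Constraint 𝓒) :
    (C ⊓ D).rename ρ = C.rename ρ ⊓ D.rename ρ := rfl

theorem realize_congr (C : Constraint 𝓒) {e e' : ℕ → M} (h : ∀ i ∈ C.fv, e i = e' i) :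
    C.1.Realize e ↔ C.1.Realize e' :=
  Language.BoundedFormula.realize_congr C.1 h

theorem realize_conj (l : List (Constraint 𝓒)) (e : ℕ → M) :
    (conj l).1.Realize e ↔ ∀ C ∈ l, C.1.Realize e := by
  induction l with
  | nil => exact iff_of_true (realize_top (𝓒 := 𝓒) e) (by simp)
  | cons C l ih =>
    rw [List.forall_mem_cons, ← ih]
    exact realize_inf _ _ _

theorem mem_fv_conj (l : List (Constraint 𝓒)) (i : ℕ) :
    i ∈ (conj l).fv ↔ ∃ C ∈ l, i ∈ C.fv := by
  induction l with
  | nil => simp [conj]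
  | cons C l ih =>
    rw [List.exists_mem_cons_iff, ← ih]
    exact mem_fv_inf _ _ _

theorem realize_eqTerm (s t : L.Term ℕ) (e : ℕ → M) :
    (eqTerm s t : Constraint 𝓒).1.Realize e ↔ s.realize e = t.realize e :=
  Language.Formula.realize_equal

theorem mem_fv_eqTerm (s t : L.Term ℕ) (i : ℕ) :
    i ∈ (eqTerm s t : Constraint 𝓒).fv ↔ i ∈ s.varFinset ∨ i ∈ t.varFinset := by
  have : (eqTerm s t : Constraint 𝓒).fv =
    (s.relabel (Sum.inl : ℕ → ℕ ⊕ Fin 0)).varFinsetLeft ∪ (t.relabel Sum.inl).varFinsetLeft := rfl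
  rw [this, Language.Term.varFinsetLeft_relabel_inl, Language.Term.varFinsetLeft_relabel_inl,
    Finset.mem_union]

end Constraint

namespace Atom

/-- The ground atom that an atom denotes in a structure under a valuation. -/
def eval (e : ℕ → M) (a : Atom L arity) : Σ p : Pred, Fin (arity p) → M :=
  ⟨a.pred, fun i => (a.args i).realize e⟩

@[simp]
theorem mem_fv (a : Atom L arity) (i : ℕ) : i ∈ a.fv ↔ ∃ k, i ∈ (a.args k).varFinset := by
  simp [fv]

theorem mem_fv_rename (ρ : Equiv.Perm ℕ) (a : Atom L arity) (i : ℕ) :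
    i ∈ (a.rename ρ).fv ↔ ρ.symm i ∈ a.fv := by
  simp only [mem_fv]
  exact exists_congr fun k => Language.Term.mem_varFinset_relabel ρ _ i

theorem eval_rename (ρ : Equiv.Perm ℕ) (a : Atom L arity) (e : ℕ → M) :
    (a.rename ρ).eval e = a.eval (e ∘ ρ) := by
  simp [eval, rename]

theorem rename_rename (ρ τ : Equiv.Perm ℕ) (a : Atom L arity) :
    (a.rename ρ).rename τ = a.rename (ρ.trans τ) := by
  simp [rename]

theorem rename_refl (a : Atom L arity) : a.rename (Equiv.refl ℕ) = a := by
  simp [rename, Language.Term.relabel_id]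

theorem eval_congr (a : Atom L arity) {e e' : ℕ → M} (h : ∀ i ∈ a.fv, e i = e' i) :
    a.eval e = a.eval e' := by
  unfold eval
  congr 1
  funext k
  exact Language.Term.realize_congr _ fun i hi => h i ((mem_fv a i).2 ⟨k, hi⟩)

/-- Values lie in a sigma type over the predicate symbols, so atoms with different symbols never
have the same value; this matches the clause `⊥` of the definition. -/
theorem realize_eqAtom (c d : Atom L arity) (e : ℕ → M) :
    (c.eqAtom d : Constraint 𝓒).1.Realize e ↔ c.eval e = d.eval e := by
  unfold eqAtom
  obtain ⟨p, s⟩ := c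
  obtain ⟨q, t⟩ := d
  split_ifs with h
  · obtain rfl : p = q := h
    rw [Constraint.realize_conj]
    simp only [eval, Sigma.mk.injEq, heq_eq_eq, true_and, funext_iff, List.forall_mem_iff_get]
    constructor
    · intro hl i
      have := hl ⟨i, by simp⟩
      simpa [Constraint.realize_eqTerm] using this
    · intro hl i
      simpa [Constraint.realize_eqTerm] using hl ⟨i, by simpa using i.2⟩
  · refine ⟨fun hb => (Constraint.realize_bot e hb).elim, fun he => ?_⟩
    exact (h (congrArg Sigma.fst he)).elim

theorem fv_eqAtom (c d : Atom L arity) {i : ℕ} (hi : i ∈ (c.eqAtom d : Constraint 𝓒).fv) :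
    i ∈ c.fv ∨ i ∈ d.fv := by
  unfold eqAtom at hi
  split_ifs at hi with h
  · rw [Constraint.mem_fv_conj] at hi
    obtain ⟨C, hC, hi⟩ := hi
    obtain ⟨k, hk, rfl⟩ := List.getElem_of_mem hC
    simp only [List.getElem_zipWith, List.getElem_ofFn, Constraint.mem_fv_eqTerm] at hi
    exact hi.imp (fun hi => (mem_fv _ _).2 ⟨_, hi⟩) (fun hi => (mem_fv _ _).2 ⟨_, hi⟩)
  · simp at hi

end Atom

@[simp]
theorem mem_fvs (A : Multiset (Atom L arity)) (i : ℕ) : i ∈ fvs A ↔ ∃ a ∈ A, i ∈ a.fv := by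
  induction A using Multiset.induction_on with
  | empty => simp [fvs]
  | cons a A ih => simpa [fvs] using or_congr_right (by simpa [fvs] using ih)

theorem mem_fvs_add (A B : Multiset (Atom L arity)) (i : ℕ) :
    i ∈ fvs (A + B) ↔ i ∈ fvs A ∨ i ∈ fvs B := by
  simp only [mem_fvs, Multiset.mem_add, or_and_right, exists_or]

theorem mem_fvs_map_rename (ρ : Equiv.Perm ℕ) (A : Multiset (Atom L arity)) (i : ℕ) :
    i ∈ fvs (A.map (Atom.rename ρ)) ↔ ρ.symm i ∈ fvs A := by
  simp only [mem_fvs, Multiset.mem_map, exists_exists_and_eq_and, Atom.mem_fv_rename]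

theorem map_rename_map_rename (ρ τ : Equiv.Perm ℕ) (A : Multiset (Atom L arity)) :
    (A.map (Atom.rename ρ)).map (Atom.rename τ) = A.map (Atom.rename (ρ.trans τ)) := by
  simp only [Multiset.map_map, Function.comp_def, Atom.rename_rename]

/-- The conjunction of the equations between the members of two families of atoms. -/
noncomputable def eqOn {ι : Type*} (t : Finset ι) (a b : ι → Atom L arity) : Constraint 𝓒 :=
  eqAtoms (t.toList.map a) (t.toList.map b)

theorem realize_eqOn {ι : Type*} (t : Finset ι) (a b : ι → Atom L arity) (e : ℕ → M) :
    (eqOn t a b : Constraint 𝓒).1.Realize e ↔ ∀ i ∈ t, (a i).eval e = (b i).eval e := by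
  unfold eqOn eqAtoms
  -- Both lists come from the same enumeration of `t`, so the zip pairs `a i` with `b i`.
  rw [Constraint.realize_conj, List.zipWith_map, List.zipWith_self]
  simp only [List.forall_mem_map, Finset.mem_toList, Atom.realize_eqAtom]

theorem fv_eqOn {ι : Type*} (t : Finset ι) (a b : ι → Atom L arity) {j : ℕ}
    (hj : j ∈ (eqOn t a b : Constraint 𝓒).fv) :
    j ∈ fvs (t.val.map a) ∨ j ∈ fvs (t.val.map b) := by
  unfold eqOn eqAtoms at hj
  rw [Constraint.mem_fv_conj, List.zipWith_map, List.zipWith_self] at hj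
  simp only [List.mem_map, Finset.mem_toList, exists_exists_and_eq_and] at hj
  obtain ⟨i, hi, hj⟩ := hj
  simp only [mem_fvs, Multiset.mem_map, Finset.mem_val, exists_exists_and_eq_and]
  exact (Atom.fv_eqAtom _ _ hj).imp (fun h => ⟨i, hi, h⟩) (fun h => ⟨i, hi, h⟩)

/-- Away from a finite set of fixed points, the variables in a finite set can be renamed by
variables that are not in that set. -/
theorem exists_perm_fresh (z W : Finset ℕ) :
    ∃ ρ : Equiv.Perm ℕ, (∀ i ∈ z, ρ i = i) ∧ ∀ i ∈ W, i ∉ z → ρ i ∉ W := by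
  obtain ⟨N, hN⟩ : ∃ N, ∀ i ∈ z ∪ W, i < N :=
    ⟨(z ∪ W).sup id + 1, fun i hi => Nat.lt_succ_of_le (Finset.le_sup (f := id) hi)⟩
  have hz : ∀ i ∈ z, i < N := fun i hi => hN i (Finset.mem_union_left _ hi)
  have hW : ∀ i ∈ W, i < N := fun i hi => hN i (Finset.mem_union_right _ hi)
  -- `f` exchanges `i` and `i + N` for all `i < N` outside `z` and fixes everything else. As `N`
  -- bounds `z` and `W`, the images `i + N` are fresh.
  let f : ℕ → ℕ := fun i =>
    if i < N ∧ i ∉ z then i + N else if N ≤ i ∧ i < N + N ∧ i - N ∉ z then i - N else i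
  have hf : Function.Involutive f := by
    intro i
    simp only [f]
    by_cases h1 : i < N ∧ i ∉ z
    · have h2 : ¬ (i + N < N ∧ i + N ∉ z) := by omega
      have h3 : N ≤ i + N ∧ i + N < N + N ∧ i + N - N ∉ z := by
        refine ⟨by omega, by omega, ?_⟩
        rw [Nat.add_sub_cancel]
        exact h1.2
      rw [if_pos h1, if_neg h2, if_pos h3]
      omega
    · by_cases h2 : N ≤ i ∧ i < N + N ∧ i - N ∉ z
      · have h3 : i - N < N ∧ i - N ∉ z := ⟨by omega, h2.2.2⟩
        rw [if_neg h1, if_pos h2, if_pos h3]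
        omega
      · rw [if_neg h1, if_neg h2, if_neg h1, if_neg h2]
  refine ⟨hf.toPerm, fun i hi => ?_, fun i hi hiz hW' => ?_⟩
  · have h1 : ¬ (i < N ∧ i ∉ z) := fun h => h.2 hi
    have h2 : ¬ (N ≤ i ∧ i < N + N ∧ i - N ∉ z) := by
      have := hz i hi
      omega
    simp only [Function.Involutive.coe_toPerm, f]
    rw [if_neg h1, if_neg h2]
  · have := hW _ hW'
    have h1 := hW i hi
    simp only [Function.Involutive.coe_toPerm, f] at this
    rw [if_pos ⟨h1, hiz⟩] at this
    omega

theorem Rule.mem_headVars_rename {𝓡 : Type*} (r : Rule 𝓡 𝓒 arity) (ρ : Equiv.Perm ℕ) (i : ℕ) :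
    i ∈ (r.rename ρ).headVars ↔ ρ.symm i ∈ r.headVars := by
  simp only [Rule.headVars, Rule.rename, mem_fvs_add, mem_fvs_map_rename]

theorem Rule.mem_fv_rename {𝓡 : Type*} (r : Rule 𝓡 𝓒 arity) (ρ : Equiv.Perm ℕ) (i : ℕ) :
    i ∈ (r.rename ρ).fv ↔ ρ.symm i ∈ r.fv := by
  simp only [Rule.fv, Finset.mem_union, Rule.mem_headVars_rename]
  simp only [Rule.rename, mem_fvs_map_rename, Constraint.mem_fv_rename]

theorem Rule.mem_lv_rename {𝓡 : Type*} (r : Rule 𝓡 𝓒 arity) (ρ : Equiv.Perm ℕ) (i : ℕ) :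
    i ∈ (r.rename ρ).lv ↔ ρ.symm i ∈ r.lv := by
  simp only [Rule.lv, Finset.mem_sdiff, Rule.mem_headVars_rename, Rule.mem_fv_rename]

theorem Rule.rename_rename {𝓡 : Type*} (r : Rule 𝓡 𝓒 arity) (ρ τ : Equiv.Perm ℕ) :
    (r.rename ρ).rename τ = r.rename (ρ.trans τ) := by
  simp only [Rule.rename, map_rename_map_rename, Constraint.rename_rename]

end CHR

/-! ### Positions in a multiset. -/

/-- Equal atoms cannot be told apart in a multiset, so occurrences are tracked by indices. This
turns the splitting of a user store into head and rest into a splitting of its index set. -/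
theorem Finset.exists_subset_map_eq {ι α : Type*} [DecidableEq ι] (a : ι → α) (s : Finset ι)
    (A B : Multiset α) (h : s.val.map a = A + B) :
    ∃ t ⊆ s, t.val.map a = A ∧ (s \ t).val.map a = B := by
  induction A using Multiset.induction_on generalizing s with
  | empty => exact ⟨∅, by simp, by simp, by simpa using h⟩
  | cons x A ih =>
    have hx : x ∈ s.val.map a := by simp [h]
    obtain ⟨i, hi, rfl⟩ := Multiset.mem_map.1 hx
    have hs : (s.erase i).val.map a = A + B := by
      rw [← Finset.insert_erase hi, Finset.insert_val_of_notMem (Finset.notMem_erase i s),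
        Multiset.map_cons, Multiset.cons_add] at h
      exact (Multiset.cons_inj_right _).1 h
    obtain ⟨t, ht, h1, h2⟩ := ih _ hs
    have hit : i ∉ t := fun h => Finset.notMem_erase i s (ht h)
    refine ⟨insert i t, Finset.insert_subset hi (ht.trans (Finset.erase_subset _ _)), ?_, ?_⟩
    · rw [Finset.insert_val_of_notMem hit, Multiset.map_cons, h1]
    · rw [← h2, Finset.sdiff_insert, Finset.erase_sdiff_comm]

/-- The fibres of `a` and `b` over each value have the same size, namely the multiplicity of that
value; bijections between fibres are put together. -/
theorem Fintype.exists_equiv_of_map_eq {ι κ α : Type*} [Fintype ι] [Fintype κ]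
    (a : ι → α) (b : κ → α)
    (h : (Finset.univ : Finset ι).val.map a = (Finset.univ : Finset κ).val.map b) :
    ∃ σ : ι ≃ κ, ∀ i, b (σ i) = a i := by
  classical
  have hc : ∀ x, Fintype.card {i // a i = x} = Fintype.card {j // b j = x} := by
    intro x
    have := congrArg (Multiset.count x) h
    rw [Multiset.count_map, Multiset.count_map] at this
    rw [Fintype.card_subtype, Fintype.card_subtype]
    simpa [Finset.card, Finset.filter, eq_comm] using this
  exact ⟨Equiv.ofFiberEquiv fun x => Fintype.equivOfCardEq (hc x),
    fun i => Equiv.ofFiberEquiv_map _ i⟩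

namespace CHR

variable {L : FirstOrder.Language.{u, v}} {𝓒 : ConstraintLanguage L} {Pred : Type w}
  {arity : Pred → ℕ} {CT : L.Theory}

/-! ### Equalities between states -/

theorem toClass_eq_of_basicEquiv {S T : State 𝓒 arity} (h : BasicEquiv CT S T) :
    S.toClass CT = T.toClass CT :=
  Quotient.sound (Relation.EqvGen.rel _ _ h)

/-- The built-in store can be replaced by one with the same projection to the variables of the
user store and the global variables. -/
theorem toClass_transform (E : Multiset (Atom L arity)) (C D : Constraint 𝓒) (x : Finset ℕ)
    (h₁ : ∀ (M : Language.Theory.ModelType.{u, v, max u v} CT) (e : ℕ → M), C.1.Realize e →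
      ∃ e' : ℕ → M, (∀ i, i ∈ fvs E ∨ i ∈ x → e' i = e i) ∧ D.1.Realize e')
    (h₂ : ∀ (M : Language.Theory.ModelType.{u, v, max u v} CT) (e : ℕ → M), D.1.Realize e →
      ∃ e' : ℕ → M, (∀ i, i ∈ fvs E ∨ i ∈ x → e' i = e i) ∧ C.1.Realize e') :
    State.toClass CT ⟨E, C, x⟩ = State.toClass CT ⟨E, D, x⟩ := by
  refine toClass_eq_of_basicEquiv (BasicEquiv.transformation E C D x fun M e => ?_)
  simp only [Finset.mem_union]
  constructor
  · rintro ⟨e₁, he₁, hC⟩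
    obtain ⟨e₂, he₂, hD⟩ := h₁ M e₁ hC
    exact ⟨e₂, fun i hi => (he₂ i hi).trans (he₁ i hi), hD⟩
  · rintro ⟨e₁, he₁, hC⟩
    obtain ⟨e₂, he₂, hD⟩ := h₂ M e₁ hC
    exact ⟨e₂, fun i hi => (he₂ i hi).trans (he₁ i hi), hD⟩

theorem toClass_transform_of_iff (E : Multiset (Atom L arity)) (C D : Constraint 𝓒)
    (x : Finset ℕ)
    (h : ∀ (M : Language.Theory.ModelType.{u, v, max u v} CT) (e : ℕ → M),
      C.1.Realize e ↔ D.1.Realize e) :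
    State.toClass CT ⟨E, C, x⟩ = State.toClass CT ⟨E, D, x⟩ :=
  toClass_transform E C D x (fun M e he => ⟨e, fun _ _ => rfl, (h M e).1 he⟩)
    (fun M e he => ⟨e, fun _ _ => rfl, (h M e).2 he⟩)

theorem toClass_of_not_satisfiable (E F : Multiset (Atom L arity)) (C D : Constraint 𝓒)
    (x y : Finset ℕ) (hC : ¬ C.Satisfiable CT) (hD : ¬ D.Satisfiable CT) :
    State.toClass CT ⟨E, C, x⟩ = State.toClass CT ⟨F, D, y⟩ := by
  have key : ∀ (E : Multiset (Atom L arity)) (C : Constraint 𝓒) (x : Finset ℕ),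
      ¬ C.Satisfiable CT → State.toClass CT ⟨E, C, x⟩ = State.toClass CT ⟨E, ⊥, x⟩ :=
    fun E C x hC => toClass_transform_of_iff E C ⊥ x fun M e =>
      iff_of_false (fun h => hC ⟨M, e, h⟩) (Constraint.realize_bot e)
  rw [key E C x hC, key F D y hD]
  exact toClass_eq_of_basicEquiv (BasicEquiv.inconsistent E F x y)

/-- Atoms can be replaced by atoms that are equal modulo the built-in store. -/
theorem toClass_rewrite {ι : Type*} (s : Finset ι) (a b : ι → Atom L arity)
    (A : Multiset (Atom L arity)) (C : Constraint 𝓒) (x : Finset ℕ)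
    (h : ∀ (M : Language.Theory.ModelType.{u, v, max u v} CT) (e : ℕ → M), C.1.Realize e →
      ∀ i ∈ s, (a i).eval e = (b i).eval e) :
    State.toClass CT ⟨A + s.val.map a, C, x⟩ = State.toClass CT ⟨A + s.val.map b, C, x⟩ := by
  classical
  induction s using Finset.induction_on generalizing A with
  | empty => rfl
  | insert i s hi ih =>
    rw [Finset.insert_val_of_notMem hi, Multiset.map_cons, Multiset.map_cons,
      ← Multiset.singleton_add, ← Multiset.singleton_add, add_comm {a i}, ← add_assoc]
    -- The equality rule needs the equation literally in the store. Since `C` implies it, it can be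
    -- added before that rule is used and removed afterwards.
    have ht : ∀ E : Multiset (Atom L arity), State.toClass CT ⟨E, C, x⟩ =
        State.toClass CT ⟨E, C ⊓ (a i).eqAtom (b i), x⟩ := fun E => by
      refine toClass_transform_of_iff _ _ _ _ fun M e => ?_
      rw [Constraint.realize_inf, Atom.realize_eqAtom]
      exact ⟨fun hC => ⟨hC, h M e hC i (Finset.mem_insert_self i s)⟩, And.left⟩
    rw [ht, toClass_eq_of_basicEquiv (BasicEquiv.equality _ (a i) (b i) C x), ← ht, add_right_comm,
      ih (A + {b i}) fun M e hC j hj => h M e hC j (Finset.mem_insert_of_mem hj), add_assoc]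

/-- Variables that do not occur in the stores may be declared global. -/
theorem toClass_globals (E : Multiset (Atom L arity)) (C : Constraint 𝓒) (x y : Finset ℕ)
    (h : ∀ i ∈ y, i ∉ x → i ∉ fvs E ∧ i ∉ C.fv) :
    State.toClass CT ⟨E, C, x⟩ = State.toClass CT ⟨E, C, y ∪ x⟩ := by
  induction y using Finset.induction_on with
  | empty => simp
  | insert j y hj ih =>
    rw [ih fun i hi => h i (Finset.mem_insert_of_mem hi), Finset.insert_union]
    by_cases hjx : j ∈ x
    · rw [Finset.insert_eq_of_mem (Finset.mem_union_right _ hjx)]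
    · have := h j (Finset.mem_insert_self j y) hjx
      exact toClass_eq_of_basicEquiv (BasicEquiv.omission E C (y ∪ x) j
        (by rw [Finset.mem_union]; tauto))

/-- `HasMatch CT a C b D x`: every solution of `C` can be changed off `x` to a solution of `D` in
such a way that the atoms `a` denote before what the atoms `b` denote afterwards. -/
def HasMatch {ι : Type*} (CT : L.Theory) (a : ι → Atom L arity) (C : Constraint 𝓒)
    (b : ι → Atom L arity) (D : Constraint 𝓒) (x : Finset ℕ) : Prop :=
  ∀ (M : Language.Theory.ModelType.{u, v, max u v} CT) (e : ℕ → M), C.1.Realize e →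
    ∃ e' : ℕ → M, (∀ i ∈ x, e' i = e i) ∧ D.1.Realize e' ∧ ∀ k, (a k).eval e = (b k).eval e'

theorem HasMatch.trans {ι : Type*} {a b c : ι → Atom L arity} {C D F : Constraint 𝓒}
    {x : Finset ℕ} (h : HasMatch CT a C b D x) (h' : HasMatch CT b D c F x) :
    HasMatch CT a C c F x := by
  intro M e hC
  obtain ⟨e₁, he₁, hD, hab⟩ := h M e hC
  obtain ⟨e₂, he₂, hF, hbc⟩ := h' M e₁ hD
  exact ⟨e₂, fun i hi => (he₂ i hi).trans (he₁ i hi), hF, fun k => (hab k).trans (hbc k)⟩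

theorem mem_fvs_univ_map {ι : Type*} [Fintype ι] (a : ι → Atom L arity) (i : ℕ) :
    i ∈ fvs (Finset.univ.val.map a) ↔ ∃ k, i ∈ (a k).fv := by
  simp [-Atom.mem_fv]

/-- A solution of `D` can be changed outside of its relevant variables so as to agree with `e`. -/
theorem exists_merge {M : Type*} [L.Structure M] {ι : Type*} [Fintype ι]
    (a b : ι → Atom L arity) (D : Constraint 𝓒)
    (x : Finset ℕ) (e e' : ℕ → M) (V : Set ℕ)
    (hV : ∀ i ∈ fvs (Finset.univ.val.map b) ∪ D.fv, i ∈ V → i ∈ x)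
    (he : ∀ i ∈ x, e' i = e i) (hD : D.1.Realize e')
    (hab : ∀ k, (a k).eval e = (b k).eval e') :
    ∃ e'' : ℕ → M, (∀ i ∈ V ∪ x, e'' i = e i) ∧ D.1.Realize e'' ∧
      ∀ k, (a k).eval e = (b k).eval e'' := by
  classical
  have agree : ∀ i ∈ fvs (Finset.univ.val.map b) ∪ D.fv,
      (if i ∈ V ∪ (x : Set ℕ) then e i else e' i) = e' i := by
    intro i hi
    split_ifs with h
    · exact (he i (h.elim (hV i hi) id)).symm
    · rfl
  refine ⟨fun i => if i ∈ V ∪ (x : Set ℕ) then e i else e' i, fun i hi => if_pos hi, ?_,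
    fun k => ?_⟩
  · exact (D.realize_congr fun i hi => agree i (Finset.mem_union_right _ hi)).2 hD
  · rw [hab k]
    refine (Atom.eval_congr _ fun i hi => agree i ?_).symm
    exact Finset.mem_union_left _ ((mem_fvs_univ_map b i).2 ⟨k, hi⟩)

/-- If only global variables are shared, a solution of `C` and the matching solution of `D` can be
glued to one valuation. So either store can be replaced by the conjunction of both with the
equations between `a` and `b`, under which the atoms are interchangeable. -/
theorem toClass_eq_of_hasMatch_of_disjoint {ι : Type*} [Fintype ι] (a b : ι → Atom L arity)
    (C D : Constraint 𝓒) (x : Finset ℕ)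
    (hdisj : ∀ i, i ∈ fvs (Finset.univ.val.map a) ∪ C.fv →
      i ∈ fvs (Finset.univ.val.map b) ∪ D.fv → i ∈ x)
    (h₁ : HasMatch CT a C b D x) (h₂ : HasMatch CT b D a C x) :
    State.toClass CT ⟨Finset.univ.val.map a, C, x⟩ =
      State.toClass CT ⟨Finset.univ.val.map b, D, x⟩ := by
  have key : ∀ (a b : ι → Atom L arity) (C D : Constraint 𝓒),
      (∀ i, i ∈ fvs (Finset.univ.val.map a) ∪ C.fv →
        i ∈ fvs (Finset.univ.val.map b) ∪ D.fv → i ∈ x) →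
      HasMatch CT a C b D x → State.toClass CT ⟨Finset.univ.val.map a, C, x⟩ =
        State.toClass CT ⟨Finset.univ.val.map a, C ⊓ D ⊓ eqOn Finset.univ a b, x⟩ := by
    intro a b C D hdisj h
    refine toClass_transform _ _ _ _ (fun M e hC => ?_) (fun M e he => ?_)
    · obtain ⟨e', he', hD, hab⟩ := h M e hC
      obtain ⟨f, hf, hfD, hfab⟩ := exists_merge a b D x e e'
        {i | i ∈ fvs (Finset.univ.val.map a) ∪ C.fv} (fun i hi hi' => hdisj i hi' hi) he' hD hab
      have hfe : ∀ i, i ∈ fvs (Finset.univ.val.map a) ∪ C.fv ∨ i ∈ x → f i = e i := hf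
      refine ⟨f, fun i hi => hfe i (hi.imp_left fun h => Finset.mem_union_left _ h), ?_⟩
      rw [Constraint.realize_inf, Constraint.realize_inf, realize_eqOn]
      refine ⟨⟨(C.realize_congr fun i hi =>
        hfe i (Or.inl (Finset.mem_union_right _ hi))).2 hC, hfD⟩, fun k _ => ?_⟩
      rw [← hfab k]
      exact Atom.eval_congr _ fun i hi => hfe i
        (Or.inl (Finset.mem_union_left _ ((mem_fvs_univ_map a i).2 ⟨k, hi⟩)))
    · rw [Constraint.realize_inf, Constraint.realize_inf] at he
      exact ⟨e, fun _ _ => rfl, he.1.1⟩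
  rw [key a b C D hdisj h₁, key b a D C (fun i hi hi' => hdisj i hi' hi) h₂]
  have hrw := toClass_rewrite (CT := CT) Finset.univ a b 0 (C ⊓ D ⊓ eqOn Finset.univ a b) x
    (fun M e he => by
      rw [Constraint.realize_inf, realize_eqOn] at he
      exact he.2)
  rw [zero_add, zero_add] at hrw
  rw [hrw]
  refine toClass_transform_of_iff _ _ _ _ fun M e => ?_
  simp only [Constraint.realize_inf, realize_eqOn]
  constructor
  · rintro ⟨⟨h1, h2⟩, h3⟩
    exact ⟨⟨h2, h1⟩, fun k hk => (h3 k hk).symm⟩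
  · rintro ⟨⟨h1, h2⟩, h3⟩
    exact ⟨⟨h2, h1⟩, fun k hk => (h3 k hk).symm⟩

/-- The solution `e` of the `ρ`-copy is carried to `e ∘ ρ ∘ τ⁻¹`, which agrees with `e` on `x`
because both permutations fix `x`. -/
theorem HasMatch.rename {ι : Type*} (a : ι → Atom L arity) (C : Constraint 𝓒) (x : Finset ℕ)
    (ρ τ : Equiv.Perm ℕ) (hρ : ∀ i ∈ x, ρ i = i) (hτ : ∀ i ∈ x, τ i = i) :
    HasMatch CT (fun k => (a k).rename ρ) (C.rename ρ) (fun k => (a k).rename τ) (C.rename τ)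
      x := by
  intro M e hC
  have hcomp : (e ∘ ρ ∘ τ.symm) ∘ τ = e ∘ ρ := by
    funext i
    simp
  refine ⟨e ∘ ρ ∘ τ.symm, fun i hi => ?_, ?_, fun k => ?_⟩
  · have : τ.symm i = i := by rw [Equiv.symm_apply_eq, hτ i hi]
    simp [this, hρ i hi]
  · rw [Constraint.realize_rename, hcomp]
    exact (Constraint.realize_rename _ _ _).1 hC
  · rw [Atom.eval_rename, Atom.eval_rename, hcomp]

theorem exists_univ_map_eq {α : Type*} (E : Multiset α) :
    ∃ (n : ℕ) (a : Fin n → α), E = Finset.univ.val.map a := by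
  obtain ⟨l, rfl⟩ := Quot.exists_rep E
  exact ⟨l.length, l.get, by simp⟩

/-- Local variables can be renamed. -/
theorem toClass_rename (E : Multiset (Atom L arity)) (C : Constraint 𝓒) (x : Finset ℕ)
    (ρ : Equiv.Perm ℕ) (hρ : ∀ i ∈ x, ρ i = i) :
    State.toClass CT ⟨E.map (Atom.rename ρ), C.rename ρ, x⟩ = State.toClass CT ⟨E, C, x⟩ := by
  obtain ⟨n, a, rfl⟩ := exists_univ_map_eq E
  have key : ∀ (V : Finset ℕ) (ρ : Equiv.Perm ℕ), (∀ i ∈ x, ρ i = i) →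
      (∀ i ∈ fvs (Finset.univ.val.map a) ∪ C.fv, i ∈ V ∧ ρ i ∈ V) →
      ∀ τ : Equiv.Perm ℕ, (∀ i ∈ x, τ i = i) → (∀ i ∈ V, i ∉ x → τ i ∉ V) →
      State.toClass CT ⟨(Finset.univ.val.map a).map (Atom.rename ρ), C.rename ρ, x⟩ =
        State.toClass CT ⟨(Finset.univ.val.map a).map (Atom.rename τ), C.rename τ, x⟩ := by
    intro V ρ hρ hV τ hτ hτV
    have h := toClass_eq_of_hasMatch_of_disjoint (CT := CT) (fun k => (a k).rename ρ)
      (fun k => (a k).rename τ) (C.rename ρ) (C.rename τ) x ?_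
      (HasMatch.rename a C x ρ τ hρ hτ) (HasMatch.rename a C x τ ρ hτ hρ)
    · rw [Multiset.map_map, Multiset.map_map]
      exact h
    · rw [← Function.comp_def (Atom.rename ρ) a, ← Function.comp_def (Atom.rename τ) a,
        ← Multiset.map_map, ← Multiset.map_map]
      intro i
      simp only [Finset.mem_union, mem_fvs_map_rename, Constraint.mem_fv_rename]
      intro h1 h2
      by_contra hix
      have hiV : i ∈ V := by
        have := (hV _ (Finset.mem_union.2 h1)).2
        rwa [Equiv.apply_symm_apply] at this
      have h3 : τ.symm i ∉ x := fun h => hix (by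
        have := hτ _ h
        rw [Equiv.apply_symm_apply] at this
        rwa [this])
      have := hτV _ (hV _ (Finset.mem_union.2 h2)).1 h3
      rw [Equiv.apply_symm_apply] at this
      exact this hiV
  set U := fvs (Finset.univ.val.map a) ∪ C.fv with hU
  -- The original and its `ρ`-copy may share local variables, so both are compared with a third copy
  -- that is fresh for the two.
  obtain ⟨τ, hτ, hτV⟩ := exists_perm_fresh x (U ∪ U.image ρ)
  have h1 := key (U ∪ U.image ρ) ρ hρ (fun i hi => ⟨Finset.mem_union_left _ hi,
    Finset.mem_union_right _ (Finset.mem_image_of_mem _ hi)⟩) τ hτ hτV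
  have h2 := key (U ∪ U.image ρ) (Equiv.refl ℕ) (fun _ _ => rfl)
    (fun i hi => ⟨Finset.mem_union_left _ hi, Finset.mem_union_left _ hi⟩) τ hτ hτV
  rw [h1, ← h2]
  simp only [Constraint.rename_refl, Atom.rename_refl, Multiset.map_id']

/-- States with the same global variables whose solutions match each other are equivalent. -/
theorem toClass_eq_of_hasMatch {ι : Type*} [Fintype ι] (a b : ι → Atom L arity)
    (C D : Constraint 𝓒) (x : Finset ℕ)
    (h₁ : HasMatch CT a C b D x) (h₂ : HasMatch CT b D a C x) :
    State.toClass CT ⟨Finset.univ.val.map a, C, x⟩ =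
      State.toClass CT ⟨Finset.univ.val.map b, D, x⟩ := by
  set U := fvs (Finset.univ.val.map a) ∪ C.fv ∪ (fvs (Finset.univ.val.map b) ∪ D.fv) with hU
  -- Renaming the local variables of the second state apart reduces the claim to the disjoint case.
  obtain ⟨τ, hτ, hτU⟩ := exists_perm_fresh x U
  have hr := HasMatch.rename (CT := CT) b D x (Equiv.refl ℕ) τ (fun _ _ => rfl) hτ
  have hr' := HasMatch.rename (CT := CT) b D x τ (Equiv.refl ℕ) hτ (fun _ _ => rfl)
  simp only [Constraint.rename_refl, Atom.rename_refl] at hr hr'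
  rw [← toClass_rename _ D x τ hτ, Multiset.map_map]
  refine toClass_eq_of_hasMatch_of_disjoint a (fun k => (b k).rename τ) C (D.rename τ) x ?_
    (h₁.trans hr) (hr'.trans h₂)
  rw [← Function.comp_def (Atom.rename τ) b, ← Multiset.map_map]
  intro i hi
  simp only [Finset.mem_union, mem_fvs_map_rename, Constraint.mem_fv_rename]
  intro h2
  by_contra hix
  have h3 : τ.symm i ∉ x := fun h => hix (by
    have := hτ _ h
    rw [Equiv.apply_symm_apply] at this
    rwa [this])
  have := hτU _ (Finset.mem_union_right _ (Finset.mem_union.2 h2)) h3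
  rw [Equiv.apply_symm_apply] at this
  exact this (Finset.mem_union_left _ hi)

/-! ### The meaning of a state -/

/-- The values that the atoms `a` can take under the solutions of `C` that agree with `f` on the
global variables `x`. -/
def outcomes {M : Type*} [L.Structure M] {ι : Type*} (a : ι → Atom L arity) (C : Constraint 𝓒)
    (x : Finset ℕ) (f : ℕ → M) : Set (ι → Σ p : Pred, Fin (arity p) → M) :=
  {g | ∃ e : ℕ → M, (∀ i ∈ x, e i = f i) ∧ C.1.Realize e ∧ ∀ k, (a k).eval e = g k}

/-- The atoms of two states can be listed in such a way that they take the same values. -/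
def SameOutcomes (CT : L.Theory) (S T : State 𝓒 arity) : Prop :=
  ∃ (n : ℕ) (a b : Fin n → Atom L arity), S.user = Finset.univ.val.map a ∧
    T.user = Finset.univ.val.map b ∧
    ∀ (M : Language.Theory.ModelType.{u, v, max u v} CT) (f : ℕ → M),
      outcomes a S.builtin S.globals f = outcomes b T.builtin T.globals f

theorem SameOutcomes.symm {S T : State 𝓒 arity} (h : SameOutcomes CT S T) :
    SameOutcomes CT T S := by
  obtain ⟨n, a, b, ha, hb, h⟩ := h
  exact ⟨n, b, a, hb, ha, fun M f => (h M f).symm⟩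

/-- The two listings of the middle user store differ by a bijection `σ` of positions, by which the
last listing is reindexed. -/
theorem SameOutcomes.trans {S T U : State 𝓒 arity} (h : SameOutcomes CT S T)
    (h' : SameOutcomes CT T U) : SameOutcomes CT S U := by
  obtain ⟨n, a, b, ha, hb, h⟩ := h
  obtain ⟨m, c, d, hc, hd, h'⟩ := h'
  obtain ⟨σ, hσ⟩ := Fintype.exists_equiv_of_map_eq b c (hb.symm.trans hc)
  refine ⟨n, a, d ∘ σ, ha, ?_, fun M f => ?_⟩
  · rw [hd, ← Multiset.map_map, ← Equiv.coe_toEmbedding, ← Finset.map_val, Finset.map_univ_equiv]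
  · rw [h M f]
    obtain rfl : c ∘ σ = b := funext hσ
    ext g
    have := Set.ext_iff.1 (h' M f) (g ∘ σ.symm)
    simpa only [outcomes, Set.mem_ofPred_eq, Function.comp_apply, σ.forall_congr_left,
      Equiv.apply_symm_apply] using this

theorem SameOutcomes.satisfiable {S T : State 𝓒 arity} (h : SameOutcomes CT S T)
    (hS : S.builtin.Satisfiable CT) : T.builtin.Satisfiable CT := by
  obtain ⟨n, a, b, -, -, h⟩ := h
  obtain ⟨M, e, he⟩ := hS
  have : (fun k => (a k).eval e) ∈ outcomes a S.builtin S.globals e :=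
    ⟨e, fun _ _ => rfl, he, fun _ => rfl⟩
  rw [h M e] at this
  obtain ⟨e', -, he', -⟩ := this
  exact ⟨M, e', he'⟩

theorem BasicEquiv.sameOutcomes {S T : State 𝓒 arity} (h : BasicEquiv CT S T) :
    (¬ S.builtin.Satisfiable CT ∧ ¬ T.builtin.Satisfiable CT) ∨ SameOutcomes CT S T := by
  induction h with
  | transformation E C D x h =>
    obtain ⟨n, a, rfl⟩ := exists_univ_map_eq E
    have key : ∀ C D : Constraint 𝓒,
        Constraint.EquivOver CT (fvs (Finset.univ.val.map a) ∪ x) C D →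
        ∀ (M : Language.Theory.ModelType.{u, v, max u v} CT) (f : ℕ → M),
          outcomes a C x f ⊆ outcomes a D x f := by
      rintro C D h M f g ⟨e, hef, hC, hg⟩
      obtain ⟨e', he', hD⟩ := (h M e).1 ⟨e, fun _ _ => rfl, hC⟩
      refine ⟨e', fun i hi => (he' i (Finset.mem_union_right _ hi)).trans (hef i hi), hD,
        fun k => ?_⟩
      rw [← hg k]
      exact Atom.eval_congr _ fun i hi =>
        he' i (Finset.mem_union_left _ ((mem_fvs_univ_map a i).2 ⟨k, hi⟩))
    exact Or.inr ⟨n, a, a, rfl, rfl, fun M f =>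
      (key C D h M f).antisymm (key D C (fun M e => (h M e).symm) M f)⟩
  | inconsistent E F x y =>
    have : ¬ (⊥ : Constraint 𝓒).Satisfiable CT := fun ⟨_, e, he⟩ => Constraint.realize_bot e he
    exact Or.inl ⟨this, this⟩
  | equality A c d C x =>
    obtain ⟨n, a, rfl⟩ := exists_univ_map_eq A
    have hcons : ∀ c : Atom L arity, Finset.univ.val.map a + {c} =
        Finset.univ.val.map (Fin.cons c a : Fin (n + 1) → Atom L arity) := fun c => by
      rw [Fin.univ_val_map, Fin.univ_val_map, List.ofFn_succ, add_comm]
      rfl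
    refine Or.inr ⟨n + 1, Fin.cons c a, Fin.cons d a, hcons c, hcons d, fun M f => ?_⟩
    ext g
    refine exists_congr fun e => and_congr_right fun _ => and_congr_right fun he => ?_
    have hcd := (Atom.realize_eqAtom c d e).1 ((Constraint.realize_inf _ _ e).1 he).2
    refine forall_congr' fun k => ?_
    refine Fin.cases ?_ (fun k => ?_) k
    · rw [Fin.cons_zero, Fin.cons_zero, hcd]
    · rw [Fin.cons_succ, Fin.cons_succ]
  | omission A C x y h =>
    obtain ⟨n, a, rfl⟩ := exists_univ_map_eq A
    refine Or.inr ⟨n, a, a, rfl, rfl, fun M f => ?_⟩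
    ext g
    constructor
    · rintro ⟨e, hef, hC, hg⟩
      -- As `y` occurs nowhere in the stores, its value can be set to the one demanded by the new
      -- global variable.
      have he : ∀ i ∈ fvs (Finset.univ.val.map a) ∪ C.fv, Function.update e y (f y) i = e i :=
        fun i hi => Function.update_of_ne (by rintro rfl; exact h hi) _ _
      refine ⟨Function.update e y (f y), fun i hi => ?_, ?_, fun k => ?_⟩
      · by_cases hiy : i = y
        · rw [hiy, Function.update_self]
        · rw [Function.update_of_ne hiy]
          have : i ∈ {y} ∪ x := hi
          rw [Finset.mem_union, Finset.mem_singleton] at this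
          exact hef i (this.resolve_left hiy)
      · exact (C.realize_congr fun i hi => he i (Finset.mem_union_right _ hi)).2 hC
      · rw [← hg k]
        exact Atom.eval_congr _ fun i hi =>
          he i (Finset.mem_union_left _ ((mem_fvs_univ_map a i).2 ⟨k, hi⟩))
    · rintro ⟨e, hef, hC, hg⟩
      exact ⟨e, fun i hi => hef i (Finset.mem_union_right _ hi), hC, hg⟩

/-- Equivalent states are both inconsistent or have the same meaning. -/
theorem sameOutcomes_of_toClass_eq {S T : State 𝓒 arity} (h : S.toClass CT = T.toClass CT) :
    (¬ S.builtin.Satisfiable CT ∧ ¬ T.builtin.Satisfiable CT) ∨ SameOutcomes CT S T := by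
  have h' : Relation.EqvGen (BasicEquiv CT) S T := Quotient.exact h
  clear h
  induction h' with
  | rel S T h => exact h.sameOutcomes
  | refl S =>
    obtain ⟨n, a, ha⟩ := exists_univ_map_eq S.user
    exact Or.inr ⟨n, a, a, ha, ha, fun _ _ => rfl⟩
  | symm S T _ ih => exact ih.imp And.symm SameOutcomes.symm
  | trans S T U _ _ ih₁ ih₂ =>
    rcases ih₁ with ⟨h1, h2⟩ | h1
    · rcases ih₂ with ⟨h3, h4⟩ | h3
      · exact Or.inl ⟨h1, h4⟩
      -- Equality of outcomes preserves satisfiability, so the two alternatives cannot be mixed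
      -- along a chain.
      · exact Or.inl ⟨h1, fun h => h2 (h3.symm.satisfiable h)⟩
    · rcases ih₂ with ⟨h3, h4⟩ | h3
      · exact Or.inl ⟨fun h => h3 (h1.satisfiable h), h4⟩
      · exact Or.inr (h1.trans h3)

end CHR

namespace CHR

variable {L : FirstOrder.Language.{u, v}} {𝓒 : ConstraintLanguage L} {Pred : Type w}
  {arity : Pred → ℕ} {CT : L.Theory} {𝓡 : Type*} {P : Set (Rule 𝓡 𝓒 arity)}

/-! ### States in a context -/

/-- The state `S` with additional constraints, seen from the global variables `x`. -/
def State.inContext (S : State 𝓒 arity) (R : Multiset (Atom L arity)) (D : Constraint 𝓒)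
    (x : Finset ℕ) : State 𝓒 arity :=
  ⟨S.user + R, S.builtin ⊓ D, x⟩

/-- No local variable of `S` is in `V`. -/
def State.LocalsAvoid (S : State 𝓒 arity) (V : Finset ℕ) : Prop :=
  ∀ i ∈ fvs S.user ∪ S.builtin.fv, i ∉ S.globals → i ∉ V

theorem univ_map_sumElim {α ι κ : Type*} [Fintype ι] [Fintype κ] (a : ι → α) (b : κ → α) :
    (Finset.univ : Finset (ι ⊕ κ)).val.map (Sum.elim a b) =
      Finset.univ.val.map a + Finset.univ.val.map b := by
  rw [← Finset.univ_disjSum_univ, Finset.val_disjSum, Multiset.disjSum, Multiset.map_add,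
    Multiset.map_map, Multiset.map_map]
  rfl

/-- Equal outcomes turn a solution for `S` into one for `T` with the same values of the atoms. Since
the local variables of `T` do not occur in the context, this solution can be corrected to agree with
the old one there. -/
theorem hasMatch_inContext {S T : State 𝓒 arity} {n m : ℕ}
    {a b : Fin n → Atom L arity} (c : Fin m → Atom L arity) (D : Constraint 𝓒) (x : Finset ℕ)
    (hb : T.user = Finset.univ.val.map b)
    (h : ∀ (M : Language.Theory.ModelType.{u, v, max u v} CT) (f : ℕ → M),
      outcomes a S.builtin S.globals f = outcomes b T.builtin T.globals f)
    (hT : T.LocalsAvoid (fvs (Finset.univ.val.map c) ∪ D.fv ∪ x)) :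
    HasMatch CT (Sum.elim a c) (S.builtin ⊓ D) (Sum.elim b c) (T.builtin ⊓ D) x := by
  intro M e he
  rw [Constraint.realize_inf] at he
  have hg : (fun k => (a k).eval e) ∈ outcomes a S.builtin S.globals e :=
    ⟨e, fun _ _ => rfl, he.1, fun _ => rfl⟩
  rw [h M e] at hg
  obtain ⟨e', hee', hT', hab⟩ := hg
  obtain ⟨f, hf, hfT, hfab⟩ := exists_merge a b T.builtin T.globals e e'
    {i | i ∈ fvs (Finset.univ.val.map c) ∪ D.fv ∪ x}
    (fun i hi hiV => by
      by_contra hig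
      exact hT i (by rwa [hb]) hig hiV) hee' hT' (fun k => (hab k).symm)
  have hf' : ∀ i ∈ fvs (Finset.univ.val.map c) ∪ D.fv ∪ x, f i = e i :=
    fun i hi => hf i (Or.inl hi)
  simp only [Finset.mem_union] at hf'
  refine ⟨f, fun i hi => hf' i (Or.inr hi), ?_, ?_⟩
  · rw [Constraint.realize_inf]
    exact ⟨hfT, (D.realize_congr fun i hi => hf' i (Or.inl (Or.inr hi))).2 he.2⟩
  · rintro (k | k)
    · exact hfab k
    · exact (Atom.eval_congr _ fun i hi =>
        hf' i (Or.inl (Or.inl ((mem_fvs_univ_map c i).2 ⟨k, hi⟩)))).symm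

/-- Adding a context is not defined on classes, as local variables might be captured. The two
avoidance hypotheses are what makes equivalence a congruence here; the new global variables `x` are
otherwise arbitrary. -/
theorem toClass_inContext {S T : State 𝓒 arity} (h : S.toClass CT = T.toClass CT)
    (R : Multiset (Atom L arity)) (D : Constraint 𝓒) (x : Finset ℕ)
    (hS : S.LocalsAvoid (fvs R ∪ D.fv ∪ x)) (hT : T.LocalsAvoid (fvs R ∪ D.fv ∪ x)) :
    (S.inContext R D x).toClass CT = (T.inContext R D x).toClass CT := by
  rcases sameOutcomes_of_toClass_eq h with ⟨h1, h2⟩ | ⟨n, a, b, ha, hb, hab⟩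
  · have key : ∀ S : State 𝓒 arity, ¬ S.builtin.Satisfiable CT →
        ¬ (S.builtin ⊓ D).Satisfiable CT :=
      fun S hS ⟨M, e, he⟩ => hS ⟨M, e, ((Constraint.realize_inf _ _ _).1 he).1⟩
    exact toClass_of_not_satisfiable _ _ _ _ _ _ (key S h1) (key T h2)
  · obtain ⟨m, c, rfl⟩ := exists_univ_map_eq R
    have := toClass_eq_of_hasMatch (Sum.elim a c) (Sum.elim b c) (S.builtin ⊓ D)
      (T.builtin ⊓ D) x (hasMatch_inContext c D x hb hab hT)
      (hasMatch_inContext c D x ha (fun M f => (hab M f).symm) hS)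
    rw [univ_map_sumElim, univ_map_sumElim, ← ha, ← hb] at this
    exact this

/-! ### Rule applications -/

namespace Rule

/-- The state to which the rule `r` is applied in the presence of `E` and `D`. -/
def source (r : Rule 𝓡 𝓒 arity) (E : Multiset (Atom L arity)) (D : Constraint 𝓒)
    (x : Finset ℕ) : State 𝓒 arity :=
  ⟨r.kept + r.removed + E, r.guard ⊓ D, x⟩

/-- The result of applying the rule `r` in the presence of `E` and `D`. -/
def target (r : Rule 𝓡 𝓒 arity) (E : Multiset (Atom L arity)) (D : Constraint 𝓒)
    (x : Finset ℕ) : State 𝓒 arity :=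
  ⟨r.kept + r.body + E, r.guard ⊓ r.builtinBody ⊓ D, x⟩

/-- The local variables of `r` do not occur in the rest of the state. -/
def Applicable (r : Rule 𝓡 𝓒 arity) (E : Multiset (Atom L arity)) (D : Constraint 𝓒)
    (x : Finset ℕ) : Prop :=
  ∀ i ∈ r.lv, i ∉ fvs E ∧ i ∉ D.fv ∧ i ∉ x

theorem applicable_iff (r : Rule 𝓡 𝓒 arity) (E : Multiset (Atom L arity)) (D : Constraint 𝓒)
    (x : Finset ℕ) : r.Applicable E D x ↔ Disjoint r.lv (fvs E ∪ D.fv ∪ x) := by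
  simp only [Applicable, Finset.disjoint_left, Finset.mem_union, not_or, and_assoc]

theorem mem_fv (r : Rule 𝓡 𝓒 arity) (i : ℕ) :
    i ∈ r.fv ↔ i ∈ fvs r.kept ∨ i ∈ fvs r.removed ∨ i ∈ r.guard.fv ∨ i ∈ fvs r.body ∨
      i ∈ r.builtinBody.fv := by
  simp only [fv, headVars, Finset.mem_union, mem_fvs_add, or_assoc]

theorem mem_headVars (r : Rule 𝓡 𝓒 arity) (i : ℕ) :
    i ∈ r.headVars ↔ i ∈ fvs r.kept ∨ i ∈ fvs r.removed := by
  simp only [headVars, mem_fvs_add]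

theorem headVars_subset_fv (r : Rule 𝓡 𝓒 arity) : r.headVars ⊆ r.fv := fun i hi =>
  (r.mem_fv i).2 (by
    rw [mem_headVars] at hi
    tauto)

theorem lv_subset_fv (r : Rule 𝓡 𝓒 arity) : r.lv ⊆ r.fv := Finset.sdiff_subset

theorem mem_vars_source (r : Rule 𝓡 𝓒 arity) (E : Multiset (Atom L arity)) (D : Constraint 𝓒)
    (x : Finset ℕ) {i : ℕ} (hi : i ∈ fvs (r.source E D x).user ∪ (r.source E D x).builtin.fv) :
    i ∈ r.fv ∪ fvs E ∪ D.fv := by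
  simp only [source, Finset.mem_union, mem_fvs_add, Constraint.mem_fv_inf, mem_fv] at hi ⊢
  tauto

theorem mem_vars_target (r : Rule 𝓡 𝓒 arity) (E : Multiset (Atom L arity)) (D : Constraint 𝓒)
    (x : Finset ℕ) {i : ℕ} (hi : i ∈ fvs (r.target E D x).user ∪ (r.target E D x).builtin.fv) :
    i ∈ r.fv ∪ fvs E ∪ D.fv := by
  simp only [target, Finset.mem_union, mem_fvs_add, Constraint.mem_fv_inf, mem_fv] at hi ⊢
  tauto

theorem toClass_source_rename (r : Rule 𝓡 𝓒 arity) (E : Multiset (Atom L arity))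
    (D : Constraint 𝓒) (x : Finset ℕ) (σ : Equiv.Perm ℕ) (hσ : ∀ i ∈ x, σ i = i) :
    ((r.rename σ).source (E.map (Atom.rename σ)) (D.rename σ) x).toClass CT =
      (r.source E D x).toClass CT := by
  refine Eq.trans ?_ (toClass_rename _ _ x σ hσ)
  simp only [source, rename, Multiset.map_add, Constraint.rename_inf]

theorem toClass_target_rename (r : Rule 𝓡 𝓒 arity) (E : Multiset (Atom L arity))
    (D : Constraint 𝓒) (x : Finset ℕ) (σ : Equiv.Perm ℕ) (hσ : ∀ i ∈ x, σ i = i) :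
    ((r.rename σ).target (E.map (Atom.rename σ)) (D.rename σ) x).toClass CT =
      (r.target E D x).toClass CT := by
  refine Eq.trans ?_ (toClass_rename _ _ x σ hσ)
  simp only [target, rename, Multiset.map_add, Constraint.rename_inf]

/-- The variables of a rule application that are not global can be chosen away from a finite set,
and variables from another finite set can be declared global. -/
theorem exists_rename_avoiding (r : Rule 𝓡 𝓒 arity) (E : Multiset (Atom L arity))
    (D : Constraint 𝓒) (x : Finset ℕ) (h : r.Applicable E D x) (V y : Finset ℕ) :
    ∃ (σ : Equiv.Perm ℕ) (E' : Multiset (Atom L arity)) (D' : Constraint 𝓒),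
      (r.rename σ).Applicable E' D' (y ∪ x) ∧
      (∀ i ∈ (r.rename σ).fv ∪ fvs E' ∪ D'.fv, i ∉ x → i ∉ V ∪ y) ∧
      ((r.rename σ).source E' D' (y ∪ x)).toClass CT = (r.source E D x).toClass CT ∧
      ((r.rename σ).target E' D' (y ∪ x)).toClass CT = (r.target E D x).toClass CT := by
  -- Global variables stay fixed. All others leave `V` and `y`, so the members of `y` outside `x` no
  -- longer occur and may be declared global.
  obtain ⟨σ, hσx, hσ⟩ := exists_perm_fresh x (V ∪ y ∪ (r.fv ∪ fvs E ∪ D.fv))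
  have hσx' : ∀ i, σ.symm i ∈ x → i ∈ x := fun i hi => by
    have := hσx _ hi
    rw [Equiv.apply_symm_apply] at this
    rwa [this]
  have avoid : ∀ i ∈ (r.rename σ).fv ∪ fvs (E.map (Atom.rename σ)) ∪ (D.rename σ).fv,
      i ∉ x → i ∉ V ∪ y := by
    intro i hi hix hiV
    have hi' : σ.symm i ∈ r.fv ∪ fvs E ∪ D.fv := by
      simpa only [Finset.mem_union, mem_fv_rename, mem_fvs_map_rename,
        Constraint.mem_fv_rename] using hi
    have := hσ _ (Finset.mem_union_right _ hi') (fun h => hix (hσx' i h))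
    rw [Equiv.apply_symm_apply] at this
    exact this (Finset.mem_union_left _ hiV)
  have hy : ∀ i ∈ y, i ∉ x →
      i ∉ (r.rename σ).fv ∪ fvs (E.map (Atom.rename σ)) ∪ (D.rename σ).fv :=
    fun i hi hix hi' => avoid i hi' hix (Finset.mem_union_right _ hi)
  refine ⟨σ, E.map (Atom.rename σ), D.rename σ, fun i hi => ?_, avoid, ?_, ?_⟩
  · have hi' : σ.symm i ∈ r.lv := (r.mem_lv_rename σ i).1 hi
    obtain ⟨h1, h2, h3⟩ := h _ hi'
    have hix : i ∉ x := fun hx => h3 (by rwa [σ.symm_apply_eq.2 (hσx i hx).symm])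
    refine ⟨by rwa [mem_fvs_map_rename], by rwa [Constraint.mem_fv_rename], ?_⟩
    rw [Finset.mem_union, not_or]
    refine ⟨fun hiy => hy i hiy hix ?_, hix⟩
    exact Finset.mem_union_left _ (Finset.mem_union_left _ (lv_subset_fv _ hi))
  · rw [← r.toClass_source_rename E D x σ hσx]
    refine (toClass_globals _ _ x y fun i hi hix => ?_).symm
    rw [← not_or, ← Finset.mem_union]
    exact fun h => hy i hi hix (mem_vars_source _ _ _ x h)
  · rw [← r.toClass_target_rename E D x σ hσx]
    refine (toClass_globals _ _ x y fun i hi hix => ?_).symm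
    rw [← not_or, ← Finset.mem_union]
    exact fun h => hy i hi hix (mem_vars_target _ _ _ x h)

/-- The conjunction of the equations between the variables in `H` and their images. -/
def linkConstraint (σ : Equiv.Perm ℕ) (H : Finset ℕ) : Constraint 𝓒 :=
  Constraint.conj ((H.sort (· ≤ ·)).map fun i =>
    Constraint.eqTerm (Language.Term.var i) (Language.Term.var (σ i)))

theorem realize_linkConstraint {M : Type*} [L.Structure M] (σ : Equiv.Perm ℕ) (H : Finset ℕ)
    (e : ℕ → M) : (linkConstraint σ H : Constraint 𝓒).1.Realize e ↔ ∀ i ∈ H, e i = e (σ i) := by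
  simp only [linkConstraint, Constraint.realize_conj, List.forall_mem_map, Finset.mem_sort,
    Constraint.realize_eqTerm, Language.Term.realize_var]

theorem fv_linkConstraint (σ : Equiv.Perm ℕ) (H : Finset ℕ) {i : ℕ}
    (hi : i ∈ (linkConstraint σ H : Constraint 𝓒).fv) : i ∈ H ∨ σ.symm i ∈ H := by
  simp only [linkConstraint, Constraint.mem_fv_conj, List.mem_map, Finset.mem_sort,
    exists_exists_and_eq_and, Constraint.mem_fv_eqTerm, Language.Term.varFinset,
    Finset.mem_singleton] at hi
  obtain ⟨j, hj, rfl | rfl⟩ := hi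
  · exact Or.inl hj
  · exact Or.inr (by rwa [Equiv.symm_apply_apply])

/-- Part of a state can be renamed by fresh variables if the variables `H` that it shares with the
rest are linked to their images by equations. -/
theorem toClass_rename_part (A E : Multiset (Atom L arity)) (C D : Constraint 𝓒)
    (U H x : Finset ℕ) (σ : Equiv.Perm ℕ) (hA : fvs A ⊆ U) (hC : C.fv ⊆ U) (hH : H ⊆ U)
    (hloc : ∀ i ∈ U, i ∉ H → i ∉ fvs E ∪ D.fv ∪ x)
    (hσ : ∀ i ∈ U, σ i ∉ U ∪ (fvs E ∪ D.fv ∪ x)) :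
    State.toClass CT ⟨A + E, C ⊓ D, x⟩ =
      State.toClass CT ⟨A.map (Atom.rename σ) + E, C.rename σ ⊓ (D ⊓ linkConstraint σ H), x⟩ := by
  obtain ⟨n, a, rfl⟩ := exists_univ_map_eq A
  obtain ⟨m, c, rfl⟩ := exists_univ_map_eq E
  rw [Multiset.map_map, ← univ_map_sumElim, ← univ_map_sumElim]
  have ha : ∀ k, ∀ i ∈ (a k).fv, i ∈ U := fun k i hi => hA ((mem_fvs_univ_map a i).2 ⟨k, hi⟩)
  have hc : ∀ k, ∀ i ∈ (c k).fv, i ∈ fvs (Finset.univ.val.map c) ∪ D.fv ∪ x := fun k i hi =>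
    Finset.mem_union_left _ (Finset.mem_union_left _ ((mem_fvs_univ_map c i).2 ⟨k, hi⟩))
  have hD : ∀ i ∈ D.fv, i ∈ fvs (Finset.univ.val.map c) ∪ D.fv ∪ x := fun i hi =>
    Finset.mem_union_left _ (Finset.mem_union_right _ hi)
  have hx : ∀ i ∈ x, i ∈ fvs (Finset.univ.val.map c) ∪ D.fv ∪ x := fun i hi =>
    Finset.mem_union_right _ hi
  generalize fvs (Finset.univ.val.map c) ∪ D.fv ∪ x = W at *
  refine toClass_eq_of_hasMatch _ _ _ _ _ (fun M e he => ?_) (fun M e he => ?_)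
  · rw [Constraint.realize_inf] at he
    -- The fresh copies `σ i` receive the values of the originals; all originals keep theirs.
    let f : ℕ → M := fun i => if σ.symm i ∈ U then e (σ.symm i) else e i
    have hfσ : ∀ i ∈ U, f (σ i) = e i := fun i hi => by
      simp only [f, Equiv.symm_apply_apply, if_pos hi]
    have hf : ∀ i, i ∈ U ∪ W → f i = e i := fun i hi => by
      refine if_neg fun h => ?_
      have := hσ _ h
      rw [Equiv.apply_symm_apply] at this
      exact this hi
    have hfW : ∀ i ∈ W, f i = e i := fun i hi => hf i (Finset.mem_union_right _ hi)
    refine ⟨f, fun i hi => hfW i (hx i hi), ?_, ?_⟩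
    · simp only [Constraint.realize_inf, Constraint.realize_rename, realize_linkConstraint]
      refine ⟨(C.realize_congr fun i hi => hfσ i (hC hi)).2 he.1,
        (D.realize_congr fun i hi => hfW i (hD i hi)).2 he.2, fun i hi => ?_⟩
      rw [hf i (Finset.mem_union_left _ (hH hi)), hfσ i (hH hi)]
    · rintro (k | k)
      · exact ((Atom.eval_rename σ (a k) f).trans
          (Atom.eval_congr _ fun i hi => hfσ i (ha k i hi))).symm
      · exact (Atom.eval_congr _ fun i hi => hfW i (hc k i hi)).symm
  · simp only [Constraint.realize_inf, Constraint.realize_rename, realize_linkConstraint] at he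
    -- Conversely, the originals take the values of their copies. This changes nothing outside the
    -- part: a variable of `U` occurring there lies in `H`, where the link equates it with its copy.
    let f : ℕ → M := fun i => if i ∈ U then e (σ i) else e i
    have hfU : ∀ i ∈ U, f i = e (σ i) := fun i hi => if_pos hi
    have hfW : ∀ i ∈ W, f i = e i := fun i hi => by
      by_cases hiU : i ∈ U
      · rw [hfU i hiU]
        by_contra hne
        exact hloc i hiU (fun h => hne (he.2.2 i h).symm) hi
      · exact if_neg hiU
    refine ⟨f, fun i hi => hfW i (hx i hi), ?_, ?_⟩
    · rw [Constraint.realize_inf]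
      exact ⟨(C.realize_congr fun i hi => hfU i (hC hi)).2 he.1,
        (D.realize_congr fun i hi => hfW i (hD i hi)).2 he.2.1⟩
    · rintro (k | k)
      · exact (Atom.eval_rename σ (a k) e).trans
          (Atom.eval_congr _ fun i hi => (hfU i (ha k i hi)).symm)
      · exact (Atom.eval_congr _ fun i hi => hfW i (hc k i hi)).symm

/-- The rule in a rule application can be chosen away from a finite set. -/
theorem exists_rename_fresh (r : Rule 𝓡 𝓒 arity) (E : Multiset (Atom L arity))
    (D : Constraint 𝓒) (x : Finset ℕ) (h : r.Applicable E D x) (V : Finset ℕ) :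
    ∃ (σ : Equiv.Perm ℕ) (D' : Constraint 𝓒),
      (∀ i ∈ (r.rename σ).fv, i ∉ V) ∧ (r.rename σ).Applicable E D' x ∧
      (∀ i ∈ D'.fv, i ∈ D.fv ∨ i ∈ r.fv ∨ i ∈ (r.rename σ).fv) ∧
      ((r.rename σ).source E D' x).toClass CT = (r.source E D x).toClass CT ∧
      ((r.rename σ).target E D' x).toClass CT = (r.target E D x).toClass CT := by
  -- No variable is held fixed: critical peaks need rules without any common variables, so even
  -- global variables in the heads are renamed. The link equations on the head variables preserve
  -- the state.
  obtain ⟨σ, -, hσ⟩ := exists_perm_fresh ∅ (V ∪ (r.fv ∪ (fvs E ∪ D.fv ∪ x)))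
  have fresh : ∀ i ∈ r.fv, σ i ∉ V ∪ (r.fv ∪ (fvs E ∪ D.fv ∪ x)) := fun i hi =>
    hσ i (Finset.mem_union_right _ (Finset.mem_union_left _ hi)) (Finset.notMem_empty i)
  have fresh' : ∀ i ∈ (r.rename σ).fv, i ∉ V ∪ (r.fv ∪ (fvs E ∪ D.fv ∪ x)) := fun i hi => by
    have := fresh _ ((r.mem_fv_rename σ i).1 hi)
    rwa [Equiv.apply_symm_apply] at this
  have hloc : ∀ i ∈ r.fv, i ∉ r.headVars → i ∉ fvs E ∪ D.fv ∪ x := fun i hi hi' => by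
    obtain ⟨h1, h2, h3⟩ := h i (Finset.mem_sdiff.2 ⟨hi, hi'⟩)
    simp only [Finset.mem_union]
    tauto
  have hσ' : ∀ i ∈ r.fv, σ i ∉ r.fv ∪ (fvs E ∪ D.fv ∪ x) :=
    fun i hi hi' => fresh i hi (Finset.mem_union_right _ hi')
  refine ⟨σ, D ⊓ linkConstraint σ r.headVars, fun i hi hiV =>
    fresh' i hi (Finset.mem_union_left _ hiV), fun i hi => ?_, fun i hi => ?_, ?_, ?_⟩
  · have h1 := fresh' i (lv_subset_fv _ hi)
    have h2 : i ∉ (linkConstraint σ r.headVars : Constraint 𝓒).fv := fun h2 => by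
      rcases fv_linkConstraint σ _ h2 with h2 | h2
      · exact h1 (Finset.mem_union_right _ (Finset.mem_union_left _ (headVars_subset_fv r h2)))
      · exact (Finset.mem_sdiff.1 ((r.mem_lv_rename σ i).1 hi)).2 h2
    rw [Constraint.mem_fv_inf]
    simp only [Finset.mem_union] at h1
    tauto
  · rw [Constraint.mem_fv_inf] at hi
    refine hi.imp_right fun hi => (fv_linkConstraint σ _ hi).imp
      (fun h => headVars_subset_fv r h) fun h => ?_
    rw [mem_fv_rename]
    exact headVars_subset_fv r h
  · refine Eq.trans ?_ (toClass_rename_part (CT := CT) (r.kept + r.removed) E r.guard D r.fv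
      r.headVars x σ ?_ ?_ (headVars_subset_fv r) hloc hσ').symm
    · simp only [source, rename, Multiset.map_add]
    · exact headVars_subset_fv r
    · intro i hi
      rw [mem_fv]
      tauto
  · refine Eq.trans ?_ (toClass_rename_part (CT := CT) (r.kept + r.body) E
      (r.guard ⊓ r.builtinBody) D r.fv r.headVars x σ ?_ ?_ (headVars_subset_fv r) hloc hσ').symm
    · simp only [target, rename, Multiset.map_add, Constraint.rename_inf]
    · intro i hi
      rw [mem_fvs_add] at hi
      rw [mem_fv]
      tauto
    · intro i hi
      rw [Constraint.mem_fv_inf] at hi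
      rw [mem_fv]
      tauto

end Rule

theorem Step.exists_rule {s t : StateClass CT 𝓒 arity} (h : Step CT P s t) :
    ∃ r₀ ∈ P, ∃ (ρ : Equiv.Perm ℕ) (E : Multiset (Atom L arity)) (D : Constraint 𝓒)
      (x : Finset ℕ), (r₀.rename ρ).Applicable E D x ∧
        ((r₀.rename ρ).source E D x).toClass CT = s ∧
        ((r₀.rename ρ).target E D x).toClass CT = t := by
  obtain ⟨r₀, r, ρ, hr₀, rfl, E, D, x, hlv⟩ := h
  exact ⟨r₀, hr₀, ρ, E, D, x, (Rule.applicable_iff _ _ _ _).2 hlv, rfl, rfl⟩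

theorem Rule.Applicable.step {r₀ : Rule 𝓡 𝓒 arity} (hr₀ : r₀ ∈ P) {ρ : Equiv.Perm ℕ}
    {E : Multiset (Atom L arity)} {D : Constraint 𝓒} {x : Finset ℕ}
    (h : (r₀.rename ρ).Applicable E D x) :
    Step CT P (((r₀.rename ρ).source E D x).toClass CT)
      (((r₀.rename ρ).target E D x).toClass CT) :=
  Step.mk r₀ _ ρ hr₀ rfl E D x ((Rule.applicable_iff _ _ _ _).1 h)

/-- The state is equivalent to the source of a rule application whose non-global variables can be
chosen off the context. The same rule then applies with the context counted as part of the remaining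
atoms and constraints. A representative of the result is returned so that steps can be chained. -/
theorem Step.inContext {S : State 𝓒 arity} {t : StateClass CT 𝓒 arity}
    (h : Step CT P (S.toClass CT) t) (R : Multiset (Atom L arity)) (D : Constraint 𝓒)
    (x : Finset ℕ) (hS : S.LocalsAvoid (fvs R ∪ D.fv ∪ x)) :
    ∃ T : State 𝓒 arity, T.toClass CT = t ∧ T.LocalsAvoid (fvs R ∪ D.fv ∪ x) ∧
      Step CT P ((S.inContext R D x).toClass CT) ((T.inContext R D x).toClass CT) := by
  obtain ⟨r₀, hr₀, ρ, E₀, D₀, x₀, happ, hs, rfl⟩ := h.exists_rule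
  obtain ⟨σ, E, F, happ', havoid, hs', ht'⟩ :=
    (r₀.rename ρ).exists_rename_avoiding (CT := CT) E₀ D₀ x₀ happ (fvs R ∪ D.fv ∪ x) ∅
  rw [Rule.rename_rename] at happ' havoid hs' ht'
  rw [Finset.empty_union] at happ' hs' ht'
  rw [Finset.union_empty] at havoid
  set r := r₀.rename (ρ.trans σ) with hr
  refine ⟨r.target E F x₀, ht', fun i hi => havoid i (Rule.mem_vars_target _ _ _ _ hi), ?_⟩
  rw [toClass_inContext (hs.symm.trans hs'.symm) R D x hS
    fun i hi => havoid i (Rule.mem_vars_source _ _ _ _ hi)]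
  have happ'' : r.Applicable (E + R) (F ⊓ D) x := by
    intro i hi
    obtain ⟨h1, h2, h3⟩ := happ' i hi
    have := havoid i (Finset.mem_union_left _ (Finset.mem_union_left _
      (Rule.lv_subset_fv _ hi))) h3
    rw [mem_fvs_add, Constraint.mem_fv_inf]
    simp only [Finset.mem_union] at this
    tauto
  have e1 : ((r.source E F x₀).inContext R D x).toClass CT =
      (r.source (E + R) (F ⊓ D) x).toClass CT := by
    simp only [State.inContext, Rule.source, add_assoc]
    exact toClass_transform_of_iff _ _ _ _ fun M e => by
      simp only [Constraint.realize_inf, and_assoc]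
  have e2 : ((r.target E F x₀).inContext R D x).toClass CT =
      (r.target (E + R) (F ⊓ D) x).toClass CT := by
    simp only [State.inContext, Rule.target, add_assoc]
    exact toClass_transform_of_iff _ _ _ _ fun M e => by
      simp only [Constraint.realize_inf, and_assoc]
  rw [e1, e2]
  exact happ''.step hr₀

theorem Steps.inContext {S : State 𝓒 arity} {t : StateClass CT 𝓒 arity}
    (h : Steps CT P (S.toClass CT) t) (R : Multiset (Atom L arity)) (D : Constraint 𝓒)
    (x : Finset ℕ) (hS : S.LocalsAvoid (fvs R ∪ D.fv ∪ x)) :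
    ∃ T : State 𝓒 arity, T.toClass CT = t ∧ T.LocalsAvoid (fvs R ∪ D.fv ∪ x) ∧
      Steps CT P ((S.inContext R D x).toClass CT) ((T.inContext R D x).toClass CT) := by
  induction h with
  | refl => exact ⟨S, rfl, hS, Relation.ReflTransGen.refl⟩
  | tail _ hstep ih =>
    obtain ⟨T, rfl, hT, hST⟩ := ih
    obtain ⟨U, hU, hUV, hTU⟩ := hstep.inContext R D x hT
    exact ⟨U, hU, hUV, hST.tail hTU⟩

theorem StepEq.inContext {S : State 𝓒 arity} {t : StateClass CT 𝓒 arity}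
    (h : StepEq CT P (S.toClass CT) t) (R : Multiset (Atom L arity)) (D : Constraint 𝓒)
    (x : Finset ℕ) (hS : S.LocalsAvoid (fvs R ∪ D.fv ∪ x)) :
    ∃ T : State 𝓒 arity, T.toClass CT = t ∧ T.LocalsAvoid (fvs R ∪ D.fv ∪ x) ∧
      StepEq CT P ((S.inContext R D x).toClass CT) ((T.inContext R D x).toClass CT) := by
  cases h with
  | refl => exact ⟨S, rfl, hS, Relation.ReflGen.refl⟩
  | single h =>
    obtain ⟨T, hT, hTV, hST⟩ := h.inContext R D x hS
    exact ⟨T, hT, hTV, Relation.ReflGen.single hST⟩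

end CHR

/-! ### Local peaks: merging two presentations, overlaps, and joinability. -/

namespace CHR

variable {L : FirstOrder.Language.{u, v}} {𝓒 : ConstraintLanguage L} {Pred : Type w}
  {arity : Pred → ℕ} {CT : L.Theory} {𝓡 : Type*} {P Q : Set (Rule 𝓡 𝓒 arity)}

/-- Two presentations of the same state can be merged. -/
theorem toClass_merge {n : ℕ} (a b : Fin n → Atom L arity) (C₁ C₂ F : Constraint 𝓒)
    (E : Multiset (Atom L arity)) (x : Finset ℕ)
    (h : ∀ (M : Language.Theory.ModelType.{u, v, max u v} CT) (f : ℕ → M),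
      outcomes a C₁ x f ⊆ outcomes b C₂ x f)
    (hV : ∀ i ∈ fvs (Finset.univ.val.map b) ∪ C₂.fv,
      i ∈ fvs (Finset.univ.val.map a) ∪ C₁.fv ∪ fvs E ∪ F.fv → i ∈ x) :
    State.toClass CT ⟨E, C₁ ⊓ F, x⟩ =
      State.toClass CT ⟨E, C₁ ⊓ C₂ ⊓ eqOn Finset.univ a b ⊓ F, x⟩ := by
  refine toClass_transform _ _ _ _ (fun M e he => ?_) (fun M e he => ?_)
  · rw [Constraint.realize_inf] at he
    obtain ⟨e', hee', hC₂, hab⟩ := h M e ⟨e, fun _ _ => rfl, he.1, fun _ => rfl⟩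
    obtain ⟨f, hf, hfC, hfab⟩ := exists_merge a b C₂ x e e' _ hV hee' hC₂ fun k => (hab k).symm
    have hf' : ∀ i, i ∈ fvs (Finset.univ.val.map a) ∪ C₁.fv ∪ fvs E ∪ F.fv ∨ i ∈ x →
        f i = e i := fun i hi => hf i hi
    simp only [Finset.mem_union] at hf'
    refine ⟨f, fun i hi => hf' i (by tauto), ?_⟩
    simp only [Constraint.realize_inf, realize_eqOn]
    refine ⟨⟨⟨(C₁.realize_congr fun i hi => hf' i (by tauto)).2 he.1, hfC⟩, fun k _ => ?_⟩,
      (F.realize_congr fun i hi => hf' i (by tauto)).2 he.2⟩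
    rw [← hfab k]
    exact Atom.eval_congr _ fun i hi => hf' i
      (Or.inl (Or.inl (Or.inl (Or.inl ((mem_fvs_univ_map a i).2 ⟨k, hi⟩)))))
  · simp only [Constraint.realize_inf] at he ⊢
    exact ⟨e, fun _ _ => rfl, he.1.1.1, he.2⟩

/-- Joinability of the critical peaks between two rules, one applied with `P` and the other
with `Q`. -/
def PeaksJoin (CT : L.Theory) (P Q : Set (Rule 𝓡 𝓒 arity)) (r₁ r₂ : Rule 𝓡 𝓒 arity) : Prop :=
  ∀ S₁ Sc S₂ : State 𝓒 arity, RuleCriticalPeak CT r₁ r₂ S₁ Sc S₂ →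
    ∃ t : StateClass CT 𝓒 arity, Steps CT Q (S₁.toClass CT) t ∧ StepEq CT P (S₂.toClass CT) t

theorem map_add_map_of_disjoint {ι α : Type*} [DecidableEq ι] (a : ι → α) {s t u : Finset ι}
    (h : s = t ∪ u) (hd : Disjoint t u) : s.val.map a = t.val.map a + u.val.map a := by
  rw [h, ← Multiset.map_add, ← Finset.disjUnion_eq_union _ _ hd]
  rfl

theorem Rule.mem_vars {r : Rule 𝓡 𝓒 arity} {E : Multiset (Atom L arity)} {D : Constraint 𝓒}
    {i : ℕ} (hi : i ∈ fvs (r.kept + r.removed + E) ∪ (r.guard ⊓ D).fv ∪ fvs (r.kept + r.body + E) ∪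
      r.builtinBody.fv) : i ∈ r.fv ∨ i ∈ fvs E ∨ i ∈ D.fv := by
  simp only [Finset.mem_union, mem_fvs_add, Constraint.mem_fv_inf, Rule.mem_fv] at hi ⊢
  tauto

/-- The built-in store of a state that arises from merging two rule applications. -/
noncomputable def mergedStore {n : ℕ} (r₁ r₂ : Rule 𝓡 𝓒 arity) (D₁ D₂ : Constraint 𝓒)
    (a b : Fin n → Atom L arity) : Constraint 𝓒 :=
  r₁.guard ⊓ D₁ ⊓ (r₂.guard ⊓ D₂) ⊓ eqOn Finset.univ a b

/-- Two applications of rules without common variables, to the same state, such that the atoms of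
the first presentation of the state, listed by `a`, correspond to those of the second, listed
by `b`. -/
structure MergedPeak {n : ℕ} (CT : L.Theory) (r₁ r₂ : Rule 𝓡 𝓒 arity)
    (E₁ E₂ : Multiset (Atom L arity)) (D₁ D₂ : Constraint 𝓒) (x : Finset ℕ)
    (a b : Fin n → Atom L arity) : Prop where
  user₁ : r₁.kept + r₁.removed + E₁ = Finset.univ.val.map a
  user₂ : r₂.kept + r₂.removed + E₂ = Finset.univ.val.map b
  apart : Disjoint r₁.fv r₂.fv
  lv₁ : ∀ i ∈ r₁.lv, i ∉ fvs E₁ ∧ i ∉ D₁.fv ∧ i ∉ x ∧ i ∉ r₂.fv ∧ i ∉ fvs E₂ ∧ i ∉ D₂.fv ∧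
    i ∉ (eqOn Finset.univ a b : Constraint 𝓒).fv
  lv₂ : ∀ i ∈ r₂.lv, i ∉ fvs E₂ ∧ i ∉ D₂.fv ∧ i ∉ x ∧ i ∉ r₁.fv ∧ i ∉ fvs E₁ ∧ i ∉ D₁.fv ∧
    i ∉ (eqOn Finset.univ a b : Constraint 𝓒).fv
  target₁ : (r₁.target E₁ D₁ x).toClass CT = State.toClass CT
    ⟨r₁.kept + r₁.body + E₁, mergedStore r₁ r₂ D₁ D₂ a b ⊓ r₁.builtinBody, x⟩
  target₂ : (r₂.target E₂ D₂ x).toClass CT = State.toClass CT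
    ⟨r₂.kept + r₂.body + E₂, mergedStore r₁ r₂ D₁ D₂ a b ⊓ r₂.builtinBody, x⟩
  sat : (mergedStore r₁ r₂ D₁ D₂ a b).Satisfiable CT

/-- Variables occurring in both presentations are global (`hsep`), so solutions of the two stores
with equal outcomes can be glued. This gives satisfiability of the merged store and lets it be
assumed in both targets. -/
theorem SameOutcomes.exists_mergedPeak {r₁ r₂ : Rule 𝓡 𝓒 arity}
    {E₁ E₂ : Multiset (Atom L arity)} {D₁ D₂ : Constraint 𝓒} {x : Finset ℕ}
    (hsame : SameOutcomes CT (r₁.source E₁ D₁ x) (r₂.source E₂ D₂ x))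
    (happ₁ : r₁.Applicable E₁ D₁ x) (happ₂ : r₂.Applicable E₂ D₂ x)
    (hr₂ : ∀ i ∈ r₂.fv, i ∉ r₁.fv ∪ fvs E₁ ∪ D₁.fv)
    (hE₂ : ∀ i ∈ fvs E₂ ∪ D₂.fv, i ∉ x → i ∉ r₁.fv ∪ fvs E₁ ∪ D₁.fv)
    (hsat : (r₁.guard ⊓ D₁).Satisfiable CT) :
    ∃ (n : ℕ) (a b : Fin n → Atom L arity), MergedPeak CT r₁ r₂ E₁ E₂ D₁ D₂ x a b := by
  obtain ⟨n, a, b, ha, hb, hab⟩ := hsame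
  change r₁.kept + r₁.removed + E₁ = _ at ha
  change r₂.kept + r₂.removed + E₂ = _ at hb
  change ∀ (M : Language.Theory.ModelType.{u, v, max u v} CT) (f : ℕ → M),
    outcomes a (r₁.guard ⊓ D₁) x f = outcomes b (r₂.guard ⊓ D₂) x f at hab
  simp only [Finset.mem_union, not_or] at hr₂ hE₂
  have hEq : ∀ i ∈ (eqOn Finset.univ a b : Constraint 𝓒).fv,
      i ∈ r₁.headVars ∨ i ∈ fvs E₁ ∨ i ∈ r₂.headVars ∨ i ∈ fvs E₂ := by
    intro i hi
    have := fv_eqOn _ _ _ hi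
    rw [← ha, ← hb] at this
    simpa only [mem_fvs_add, or_assoc, Rule.headVars] using this
  have hsep : ∀ i, (i ∈ r₁.fv ∨ i ∈ fvs E₁ ∨ i ∈ D₁.fv) → (i ∈ r₂.fv ∨ i ∈ fvs E₂ ∨ i ∈ D₂.fv) →
      i ∈ x := by
    intro i h1 h2
    by_contra h3
    have h4 : (i ∉ r₁.fv ∧ i ∉ fvs E₁) ∧ i ∉ D₁.fv :=
      h2.elim (fun h => hr₂ i h) fun h => hE₂ i h h3
    rcases h1 with h | h | h
    · exact h4.1.1 h
    · exact h4.1.2 h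
    · exact h4.2 h
  refine ⟨n, a, b, ha, hb, ?_, ?_, ?_, ?_, ?_, ?_⟩
  · exact Finset.disjoint_left.2 fun i h1 h2 => (hr₂ i h2).1.1 h1
  · intro i hi
    obtain ⟨h1, h2, h3⟩ := happ₁ i hi
    obtain ⟨h4, h5⟩ := Finset.mem_sdiff.1 hi
    have h6 : i ∉ r₂.fv := fun h => (hr₂ i h).1.1 h4
    have h7 : i ∉ fvs E₂ := fun h => (hE₂ i (Or.inl h) h3).1.1 h4
    refine ⟨h1, h2, h3, h6, h7, fun h => (hE₂ i (Or.inr h) h3).1.1 h4, fun h => ?_⟩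
    rcases hEq i h with h | h | h | h
    · exact h5 h
    · exact h1 h
    · exact h6 (r₂.headVars_subset_fv h)
    · exact h7 h
  · intro i hi
    obtain ⟨h1, h2, h3⟩ := happ₂ i hi
    obtain ⟨h4, h5⟩ := Finset.mem_sdiff.1 hi
    obtain ⟨⟨h6, h7⟩, h8⟩ := hr₂ i h4
    refine ⟨h1, h2, h3, h6, h7, h8, fun h => ?_⟩
    rcases hEq i h with h | h | h | h
    · exact h6 (r₁.headVars_subset_fv h)
    · exact h7 h
    · exact h5 h
    · exact h1 h
  · refine Eq.trans (toClass_transform_of_iff _ _ (r₁.guard ⊓ D₁ ⊓ r₁.builtinBody) _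
      fun M e => ?_) (toClass_merge a b _ (r₂.guard ⊓ D₂) r₁.builtinBody _ x
        (fun M f => (hab M f).subset) fun i hi hi' => hsep i ?_ ?_)
    · simp only [Constraint.realize_inf, and_right_comm]
    · rw [← ha] at hi'
      exact Rule.mem_vars hi'
    · rw [← hb] at hi
      exact Rule.mem_vars (Finset.mem_union_left _ (Finset.mem_union_left _ hi))
  · refine Eq.trans (toClass_transform_of_iff _ _ (r₂.guard ⊓ D₂ ⊓ r₂.builtinBody) _
      fun M e => ?_) (Eq.trans (toClass_merge b a _ (r₁.guard ⊓ D₁) r₂.builtinBody _ x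
        (fun M f => (hab M f).symm.subset) fun i hi hi' => hsep i ?_ ?_)
        (toClass_transform_of_iff _ _ _ _ fun M e => ?_))
    · simp only [Constraint.realize_inf, and_right_comm]
    · rw [← ha] at hi
      exact Rule.mem_vars (Finset.mem_union_left _ (Finset.mem_union_left _ hi))
    · rw [← hb] at hi'
      exact Rule.mem_vars hi'
    · have : (eqOn Finset.univ b a : Constraint 𝓒).1.Realize e ↔
          (eqOn Finset.univ a b : Constraint 𝓒).1.Realize e := by
        simp only [realize_eqOn, eq_comm]
      rw [mergedStore]
      simp only [Constraint.realize_inf]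
      rw [this, and_comm (a := r₂.guard.1.Realize e ∧ _)]
  · obtain ⟨M, e, he⟩ := hsat
    have hg : (fun k => (a k).eval e) ∈ outcomes a (r₁.guard ⊓ D₁) x e :=
      ⟨e, fun _ _ => rfl, he, fun _ => rfl⟩
    rw [hab M e] at hg
    obtain ⟨e', hee', hD₂, he'⟩ := hg
    obtain ⟨f, hf, hfC, hfab⟩ := exists_merge a b (r₂.guard ⊓ D₂) x e e'
      {i | i ∈ r₁.fv ∨ i ∈ fvs E₁ ∨ i ∈ D₁.fv} (fun i hi hi' => hsep i hi' (by
        rw [← hb] at hi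
        exact Rule.mem_vars (Finset.mem_union_left _ (Finset.mem_union_left _ hi))))
      hee' hD₂ fun k => (he' k).symm
    have hf' : ∀ i ∈ fvs (Finset.univ.val.map a) ∪ (r₁.guard ⊓ D₁).fv, f i = e i := by
      intro i hi
      rw [← ha] at hi
      exact hf i (Or.inl (Rule.mem_vars (Finset.mem_union_left _ (Finset.mem_union_left _ hi))))
    refine ⟨M, f, ?_⟩
    rw [mergedStore, Constraint.realize_inf, Constraint.realize_inf, realize_eqOn]
    refine ⟨⟨(Constraint.realize_congr _ fun i hi => hf' i (Finset.mem_union_right _ hi)).2 he,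
      hfC⟩, fun k _ => ?_⟩
    rw [← hfab k]
    exact Atom.eval_congr _ fun i hi =>
      hf' i (Finset.mem_union_left _ ((mem_fvs_univ_map a i).2 ⟨k, hi⟩))

/-- The decomposition of two heads into the overlap `I` and the remaining parts `s`, `t`, and of the
other atoms into these parts and the common rest `u`. -/
structure Overlap {n : ℕ} (r₁ r₂ : Rule 𝓡 𝓒 arity) (E₁ E₂ : Multiset (Atom L arity))
    (a b : Fin n → Atom L arity) (s t I u : Finset (Fin n)) : Prop where
  head₁ : r₁.kept + r₁.removed = s.val.map a + I.val.map a
  head₂ : r₂.kept + r₂.removed = t.val.map b + I.val.map b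
  rest₁ : E₁ = t.val.map a + u.val.map a
  rest₂ : E₂ = s.val.map b + u.val.map b

theorem exists_overlap {n : ℕ} {r₁ r₂ : Rule 𝓡 𝓒 arity} {E₁ E₂ : Multiset (Atom L arity)}
    {a b : Fin n → Atom L arity}
    (ha : r₁.kept + r₁.removed + E₁ = Finset.univ.val.map a)
    (hb : r₂.kept + r₂.removed + E₂ = Finset.univ.val.map b) :
    ∃ s t I u : Finset (Fin n), Overlap r₁ r₂ E₁ E₂ a b s t I u := by
  obtain ⟨s, -, hs, hs'⟩ := Finset.exists_subset_map_eq a Finset.univ _ _ ha.symm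
  obtain ⟨t, -, ht, ht'⟩ := Finset.exists_subset_map_eq b Finset.univ _ _ hb.symm
  -- Here `s` and `t` are the positions of the first and of the second head.
  refine ⟨s \ t, t \ s, s ∩ t, Finset.univ \ (s ∪ t), hs.symm.trans ?_, ht.symm.trans ?_,
    hs'.symm.trans ?_, ht'.symm.trans ?_⟩ <;>
  · refine map_add_map_of_disjoint _ (Finset.ext fun i => ?_) (Finset.disjoint_left.2 fun i => ?_) <;>
    simp only [Finset.mem_sdiff, Finset.mem_union, Finset.mem_inter, Finset.mem_univ] <;>
    tauto

namespace MergedPeak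

variable {n : ℕ} {r₁ r₂ : Rule 𝓡 𝓒 arity} {E₁ E₂ : Multiset (Atom L arity)}
  {D₁ D₂ : Constraint 𝓒} {x : Finset ℕ} {a b : Fin n → Atom L arity} {s t I u : Finset (Fin n)}

theorem rewrite (F : Constraint 𝓒) (v : Finset (Fin n)) (A : Multiset (Atom L arity))
    (hF : ∀ (M : Language.Theory.ModelType.{u, v, max u v} CT) (e : ℕ → M),
        F.1.Realize e → (eqOn Finset.univ a b : Constraint 𝓒).1.Realize e) :
    State.toClass CT ⟨A + v.val.map a, F, x⟩ = State.toClass CT ⟨A + v.val.map b, F, x⟩ :=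
  toClass_rewrite v a b A F x fun M e he k _ =>
    (realize_eqOn _ _ _ _).1 (hF M e he) k (Finset.mem_univ k)

theorem realize_mergedStore_inf (F : Constraint 𝓒)
    (M : Language.Theory.ModelType.{u, v, max u v} CT) (e : ℕ → M)
    (h : (mergedStore r₁ r₂ D₁ D₂ a b ⊓ F).1.Realize e) :
    (eqOn Finset.univ a b : Constraint 𝓒).1.Realize e := by
  simp only [mergedStore, Constraint.realize_inf] at h
  exact h.1.2

/-- Two rule applications that overlap critically are joinable if the critical peak is. -/
theorem exists_join_of_critical (h : MergedPeak CT r₁ r₂ E₁ E₂ D₁ D₂ x a b)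
    (o : Overlap r₁ r₂ E₁ E₂ a b s t I u) (hjoin : PeaksJoin CT P Q r₁ r₂)
    (hcrit : ¬ I.val.map a ≤ r₁.kept ∨ ¬ I.val.map b ≤ r₂.kept) :
    ∃ t : StateClass CT 𝓒 arity, Steps CT Q ((r₁.target E₁ D₁ x).toClass CT) t ∧
      StepEq CT P ((r₂.target E₂ D₂ x).toClass CT) t := by
  -- An empty overlap would lie in both kept heads, contrary to `hcrit`; this gives the non-empty
  -- sequences that a critical peak requires.
  have hI : I ≠ ∅ := by
    rintro rfl
    simp at hcrit
  have hlist : ∀ c : Fin n → Atom L arity,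
      ((I.toList.map c : List (Atom L arity)) : Multiset (Atom L arity)) = I.val.map c := by
    intro c
    rw [← Multiset.map_coe, Finset.coe_toList]
  have hne : ∀ c : Fin n → Atom L arity, I.toList.map c ≠ [] := fun c => by
    simpa [List.map_eq_nil_iff] using hI
  have heqI : ∀ (M : Language.Theory.ModelType.{u, v, max u v} CT) (e : ℕ → M),
      (eqOn Finset.univ a b : Constraint 𝓒).1.Realize e →
        (eqOn I a b : Constraint 𝓒).1.Realize e := fun M e he =>
    (realize_eqOn _ _ _ _).2 fun k _ => (realize_eqOn _ _ _ _).1 he k (Finset.mem_univ k)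
  have hpeak := RuleCriticalPeak.mk (CT := CT) (r₁ := r₁) (r₂ := r₂) (s.val.map a) (t.val.map b)
    (I.toList.map a) (I.toList.map b) (eqOn I a b ⊓ r₁.guard ⊓ r₂.guard)
    (r₁.headVars ∪ r₂.headVars) h.apart (by rw [hlist]; exact o.head₁)
    (by rw [hlist]; exact o.head₂) (hne a) (hne b) (by simp) rfl rfl (by
      obtain ⟨M, e, he⟩ := h.sat
      refine ⟨M, e, ?_⟩
      simp only [mergedStore, Constraint.realize_inf] at he ⊢
      exact ⟨⟨heqI M e he.2, he.1.1.1⟩, he.1.2.1⟩) (by rwa [hlist, hlist])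
  obtain ⟨t₀, hQ, hP⟩ := hjoin _ _ _ hpeak
  have huE : ∀ i, i ∉ fvs E₁ → i ∉ fvs (u.val.map a) := fun i hi hi' => hi (by
    rw [o.rest₁, mem_fvs_add]
    exact Or.inr hi')
  -- The built-in part of the context: what the merged store has beyond the critical ancestor. The
  -- user part is the common rest `u`.
  set K : Constraint 𝓒 := D₁ ⊓ D₂ ⊓ eqOn Finset.univ a b with hK
  have hlv : ∀ i, i ∈ r₁.lv ∨ i ∈ r₂.lv → i ∉ fvs (u.val.map a) ∪ K.fv ∪ x := by
    intro i hi
    simp only [hK, Finset.mem_union, Constraint.mem_fv_inf, not_or]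
    rcases hi with hi | hi
    · obtain ⟨h1, h2, h3, -, -, h6, h7⟩ := h.lv₁ i hi
      exact ⟨⟨huE i h1, ⟨h2, h6⟩, h7⟩, h3⟩
    · obtain ⟨-, h2, h3, -, h5, h6, h7⟩ := h.lv₂ i hi
      exact ⟨⟨huE i h5, ⟨h6, h2⟩, h7⟩, h3⟩
  have hlocal : ∀ i, i ∈ r₁.fv ∨ i ∈ r₂.fv → i ∉ r₁.headVars ∪ r₂.headVars →
      i ∉ fvs (u.val.map a) ∪ K.fv ∪ x := by
    intro i hi hi'
    rw [Finset.mem_union, not_or] at hi'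
    exact hlv i (hi.imp (fun h => Finset.mem_sdiff.2 ⟨h, hi'.1⟩)
      fun h => Finset.mem_sdiff.2 ⟨h, hi'.2⟩)
  have hIv : ∀ i ∈ (eqOn I a b : Constraint 𝓒).fv, i ∈ r₁.fv ∨ i ∈ r₂.fv := by
    intro i hi
    refine (fv_eqOn _ _ _ hi).imp (fun h => r₁.headVars_subset_fv ?_)
      fun h => r₂.headVars_subset_fv ?_
    · rw [Rule.headVars, o.head₁, mem_fvs_add]
      exact Or.inr h
    · rw [Rule.headVars, o.head₂, mem_fvs_add]
      exact Or.inr h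
  have hsv : ∀ i ∈ fvs (s.val.map a), i ∈ r₁.fv := fun i hi => r₁.headVars_subset_fv (by
    rw [Rule.headVars, o.head₁, mem_fvs_add]
    exact Or.inl hi)
  have htv : ∀ i ∈ fvs (t.val.map b), i ∈ r₂.fv := fun i hi => r₂.headVars_subset_fv (by
    rw [Rule.headVars, o.head₂, mem_fvs_add]
    exact Or.inl hi)
  have hv : ∀ (r : Rule 𝓡 𝓒 arity) (i : ℕ),
      i ∈ fvs r.kept ∨ i ∈ fvs r.body ∨ i ∈ r.guard.fv ∨ i ∈ r.builtinBody.fv → i ∈ r.fv := by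
    intro r i hi
    rw [Rule.mem_fv]
    tauto
  obtain ⟨T₁, rfl, hT₁, hQ'⟩ := hQ.inContext (u.val.map a) K x (by
    intro i hi
    refine hlocal i ?_
    simp only [Finset.mem_union, mem_fvs_add, Constraint.mem_fv_inf] at hi
    rcases hi with ((hi | hi) | hi) | ((hi | hi) | hi) | hi
    · exact Or.inl (hv r₁ i (Or.inl hi))
    · exact Or.inl (hv r₁ i (Or.inr (Or.inl hi)))
    · exact Or.inr (htv i hi)
    · exact hIv i hi
    · exact Or.inl (hv r₁ i (Or.inr (Or.inr (Or.inl hi))))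
    · exact Or.inr (hv r₂ i (Or.inr (Or.inr (Or.inl hi))))
    · exact Or.inl (hv r₁ i (Or.inr (Or.inr (Or.inr hi)))))
  obtain ⟨T₂, hT, hT₂, hP'⟩ := hP.inContext (u.val.map a) K x (by
    intro i hi
    refine hlocal i ?_
    simp only [Finset.mem_union, mem_fvs_add, Constraint.mem_fv_inf] at hi
    rcases hi with ((hi | hi) | hi) | ((hi | hi) | hi) | hi
    · exact Or.inr (hv r₂ i (Or.inl hi))
    · exact Or.inr (hv r₂ i (Or.inr (Or.inl hi)))
    · exact Or.inl (hsv i hi)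
    · exact hIv i hi
    · exact Or.inl (hv r₁ i (Or.inr (Or.inr (Or.inl hi))))
    · exact Or.inr (hv r₂ i (Or.inr (Or.inr (Or.inl hi))))
    · exact Or.inr (hv r₂ i (Or.inr (Or.inr (Or.inr hi)))))
  -- The two representatives of the joining state both avoid the context, so they still agree inside
  -- it.
  rw [toClass_inContext hT _ _ _ hT₂ hT₁] at hP'
  have store : ∀ (F : Constraint 𝓒) (M : Language.Theory.ModelType.{u, v, max u v} CT)
      (e : ℕ → M), (mergedStore r₁ r₂ D₁ D₂ a b ⊓ F).1.Realize e ↔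
        (eqOn I a b ⊓ r₁.guard ⊓ r₂.guard ⊓ F ⊓ K).1.Realize e := by
    intro F M e
    have := heqI M e
    simp only [mergedStore, hK, Constraint.realize_inf]
    constructor
    · rintro ⟨⟨⟨⟨h1, h2⟩, h3, h4⟩, h5⟩, h6⟩
      exact ⟨⟨⟨⟨this h5, h1⟩, h3⟩, h6⟩, ⟨h2, h4⟩, h5⟩
    · rintro ⟨⟨⟨⟨-, h1⟩, h3⟩, h6⟩, ⟨h2, h4⟩, h5⟩
      exact ⟨⟨⟨⟨h1, h2⟩, h3, h4⟩, h5⟩, h6⟩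
  refine ⟨(T₁.inContext (u.val.map a) K x).toClass CT, ?_, ?_⟩
  -- In the peak, the part of the second head outside the overlap is written with `b`; the equations
  -- in the store allow this change at the positions `t`.
  · convert hQ' using 1
    rw [h.target₁, o.rest₁, add_comm (t.val.map a), ← add_assoc,
      rewrite _ t _ (realize_mergedStore_inf _), toClass_transform_of_iff _ _ _ _ (store _)]
    simp only [State.inContext, add_right_comm]
  · convert hP' using 1
    rw [h.target₂, o.rest₂, ← add_assoc, ← rewrite _ u _ (realize_mergedStore_inf _),
      add_right_comm, ← rewrite _ s _ (realize_mergedStore_inf _),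
      toClass_transform_of_iff _ _ _ _ (store _)]
    simp only [State.inContext, add_right_comm]

/-- Two rule applications that do not overlap critically are joinable in one step on each side. -/
theorem exists_join_of_not_critical {R₁ R₂ : Rule 𝓡 𝓒 arity} (hR₁ : R₁ ∈ P) (hR₂ : R₂ ∈ Q)
    {ρ₁ ρ₂ : Equiv.Perm ℕ} (hr₁ : r₁ = R₁.rename ρ₁) (hr₂ : r₂ = R₂.rename ρ₂)
    (h : MergedPeak CT r₁ r₂ E₁ E₂ D₁ D₂ x a b)
    (o : Overlap r₁ r₂ E₁ E₂ a b s t I u)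
    (hk₁ : I.val.map a ≤ r₁.kept) (hk₂ : I.val.map b ≤ r₂.kept) :
    ∃ t : StateClass CT 𝓒 arity, Steps CT Q ((r₁.target E₁ D₁ x).toClass CT) t ∧
      StepEq CT P ((r₂.target E₂ D₂ x).toClass CT) t := by
  -- The first rule keeps the overlap and leaves the positions `t` untouched, so the whole head of
  -- the second is still present, with `K₁`, the first body and `u` as the rest; symmetrically with
  -- `K₂`.
  obtain ⟨K₁, hK₁⟩ := Multiset.le_iff_exists_add.1 hk₁
  obtain ⟨K₂, hK₂⟩ := Multiset.le_iff_exists_add.1 hk₂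
  have huE : ∀ i, i ∉ fvs E₁ → i ∉ fvs (u.val.map a) := fun i hi hi' => hi (by
    rw [o.rest₁, mem_fvs_add]
    exact Or.inr hi')
  have hv₁ : ∀ i, i ∉ r₁.fv → i ∉ fvs K₁ ∧ i ∉ fvs r₁.body ∧ i ∉ r₁.guard.fv ∧
      i ∉ r₁.builtinBody.fv := by
    intro i hi
    rw [Rule.mem_fv, hK₁, mem_fvs_add] at hi
    tauto
  have hv₂ : ∀ i, i ∉ r₂.fv → i ∉ fvs K₂ ∧ i ∉ fvs r₂.body ∧ i ∉ r₂.guard.fv ∧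
      i ∉ r₂.builtinBody.fv := by
    intro i hi
    rw [Rule.mem_fv, hK₂, mem_fvs_add] at hi
    tauto
  set C : Constraint 𝓒 := D₁ ⊓ D₂ ⊓ eqOn Finset.univ a b with hC
  have app₂ : r₂.Applicable (K₁ + r₁.body + u.val.map a) (r₁.guard ⊓ r₁.builtinBody ⊓ C) x := by
    intro i hi
    obtain ⟨-, h2, h3, h4, h5, h6, h7⟩ := h.lv₂ i hi
    obtain ⟨v1, v2, v3, v4⟩ := hv₁ i h4
    simp only [hC, mem_fvs_add, Constraint.mem_fv_inf, not_or]
    exact ⟨⟨⟨v1, v2⟩, huE i h5⟩, ⟨⟨v3, v4⟩, ⟨h6, h2⟩, h7⟩, h3⟩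
  have app₁ : r₁.Applicable (K₂ + r₂.body + u.val.map a) (r₂.guard ⊓ r₂.builtinBody ⊓ C) x := by
    intro i hi
    obtain ⟨h1, h2, h3, h4, -, h6, h7⟩ := h.lv₁ i hi
    obtain ⟨v1, v2, v3, v4⟩ := hv₂ i h4
    simp only [hC, mem_fvs_add, Constraint.mem_fv_inf, not_or]
    exact ⟨⟨⟨v1, v2⟩, huE i h1⟩, ⟨⟨v3, v4⟩, ⟨h2, h6⟩, h7⟩, h3⟩
  have step₂ : Step CT Q
      ((r₂.source (K₁ + r₁.body + u.val.map a) (r₁.guard ⊓ r₁.builtinBody ⊓ C) x).toClass CT)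
      ((r₂.target (K₁ + r₁.body + u.val.map a) (r₁.guard ⊓ r₁.builtinBody ⊓ C) x).toClass CT) := by
    subst hr₂
    exact app₂.step hR₂
  have step₁ : Step CT P
      ((r₁.source (K₂ + r₂.body + u.val.map a) (r₂.guard ⊓ r₂.builtinBody ⊓ C) x).toClass CT)
      ((r₁.target (K₂ + r₂.body + u.val.map a) (r₂.guard ⊓ r₂.builtinBody ⊓ C) x).toClass CT) := by
    subst hr₁
    exact app₁.step hR₁
  have store₁ : ∀ (M : Language.Theory.ModelType.{u, v, max u v} CT) (e : ℕ → M),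
      (mergedStore r₁ r₂ D₁ D₂ a b ⊓ r₁.builtinBody).1.Realize e ↔
        (r₂.guard ⊓ (r₁.guard ⊓ r₁.builtinBody ⊓ C)).1.Realize e := by
    intro M e
    simp only [mergedStore, hC, Constraint.realize_inf]
    tauto
  have store₂ : ∀ (M : Language.Theory.ModelType.{u, v, max u v} CT) (e : ℕ → M),
      (mergedStore r₁ r₂ D₁ D₂ a b ⊓ r₂.builtinBody).1.Realize e ↔
        (r₁.guard ⊓ (r₂.guard ⊓ r₂.builtinBody ⊓ C)).1.Realize e := by
    intro M e
    simp only [mergedStore, hC, Constraint.realize_inf]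
    tauto
  have store : ∀ (M : Language.Theory.ModelType.{u, v, max u v} CT) (e : ℕ → M),
      (r₁.guard ⊓ r₁.builtinBody ⊓ (r₂.guard ⊓ r₂.builtinBody ⊓ C)).1.Realize e ↔
        (r₂.guard ⊓ r₂.builtinBody ⊓ (r₁.guard ⊓ r₁.builtinBody ⊓ C)).1.Realize e := by
    intro M e
    simp only [Constraint.realize_inf]
    tauto
  have e₁ : (r₁.target E₁ D₁ x).toClass CT =
      (r₂.source (K₁ + r₁.body + u.val.map a) (r₁.guard ⊓ r₁.builtinBody ⊓ C) x).toClass CT := by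
    rw [h.target₁, o.rest₁, hK₁, show I.val.map a + K₁ + r₁.body + (t.val.map a + u.val.map a) =
      K₁ + r₁.body + u.val.map a + t.val.map a + I.val.map a by abel,
      rewrite _ I _ (realize_mergedStore_inf _), add_right_comm,
      rewrite _ t _ (realize_mergedStore_inf _), toClass_transform_of_iff _ _ _ _ store₁,
      Rule.source, o.head₂]
    congr 2
    abel
  have e₂ : (r₂.target E₂ D₂ x).toClass CT =
      (r₁.source (K₂ + r₂.body + u.val.map a) (r₂.guard ⊓ r₂.builtinBody ⊓ C) x).toClass CT := by
    rw [h.target₂, o.rest₂, hK₂, show I.val.map b + K₂ + r₂.body + (s.val.map b + u.val.map b) =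
      K₂ + r₂.body + s.val.map b + I.val.map b + u.val.map b by abel,
      ← rewrite _ u _ (realize_mergedStore_inf _), add_right_comm,
      ← rewrite _ I _ (realize_mergedStore_inf _), add_right_comm _ (s.val.map b),
      add_right_comm _ (s.val.map b),
      ← rewrite _ s _ (realize_mergedStore_inf _), toClass_transform_of_iff _ _ _ _ store₂,
      Rule.source, o.head₁]
    congr 2
    abel
  refine ⟨_, e₁ ▸ Relation.ReflTransGen.single step₂, ?_⟩
  rw [e₂]
  have e₃ : (r₂.target (K₁ + r₁.body + u.val.map a) (r₁.guard ⊓ r₁.builtinBody ⊓ C) x).toClass CT =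
      (r₁.target (K₂ + r₂.body + u.val.map a) (r₂.guard ⊓ r₂.builtinBody ⊓ C) x).toClass CT := ?_
  · rw [e₃]
    exact Relation.ReflGen.single step₁
  rw [Rule.target, Rule.target, hK₁, hK₂, toClass_transform_of_iff _ _ _ _ store,
    show I.val.map a + K₁ + r₁.body + (K₂ + r₂.body + u.val.map a) =
      K₁ + r₁.body + K₂ + r₂.body + u.val.map a + I.val.map a by abel,
    rewrite _ I]
  · congr 2
    abel
  · intro M e he
    simp only [hC, Constraint.realize_inf] at he
    exact he.2.2.2

end MergedPeak

/-- Strong commutation of two programs the critical peaks of which are joinable. -/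
theorem exists_join_of_step_of_step
    (hpeak : ∀ S₁ Sc S₂ : State 𝓒 arity, CriticalPeak CT P Q S₁ Sc S₂ →
      ∃ t : StateClass CT 𝓒 arity, Steps CT Q (S₁.toClass CT) t ∧ StepEq CT P (S₂.toClass CT) t)
    {c c₁ c₂ : StateClass CT 𝓒 arity} (h₁ : Step CT P c c₁) (h₂ : Step CT Q c c₂) :
    ∃ t, Steps CT Q c₁ t ∧ StepEq CT P c₂ t := by
  obtain ⟨R₁, hR₁, ρ₁, E₁', D₁', x₁, happ₁', hs₁', ht₁'⟩ := h₁.exists_rule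
  obtain ⟨R₂, hR₂, ρ₂, E₂', D₂', x₂, happ₂', hs₂', ht₂'⟩ := h₂.exists_rule
  -- Three renamings bring the peak into mergeable form. The first two give both presentations the
  -- global variables `x₂ ∪ x₁`, the second also moving the non-global variables of the `Q`-step off
  -- those of the `P`-step; the third frees the second rule from `V` altogether.
  obtain ⟨σ₁, E₁, D₁, happ₁, -, hs₁, ht₁⟩ :=
    (R₁.rename ρ₁).exists_rename_avoiding (CT := CT) E₁' D₁' x₁ happ₁' ∅ x₂
  rw [Rule.rename_rename] at happ₁ hs₁ ht₁
  set r₁ := R₁.rename (ρ₁.trans σ₁) with hr₁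
  set V := r₁.fv ∪ fvs E₁ ∪ D₁.fv with hV
  obtain ⟨σ₂, E₂, F₂, happ₂'', havoid, hs₂'', ht₂''⟩ :=
    (R₂.rename ρ₂).exists_rename_avoiding (CT := CT) E₂' D₂' x₂ happ₂' V x₁
  rw [Rule.rename_rename] at happ₂'' havoid hs₂'' ht₂''
  rw [Finset.union_comm x₁ x₂] at happ₂'' hs₂'' ht₂''
  set x := x₂ ∪ x₁ with hx
  obtain ⟨σ₃, D₂, hfresh, happ₂, hD₂, hs₂, ht₂⟩ :=
    (R₂.rename (ρ₂.trans σ₂)).exists_rename_fresh (CT := CT) E₂ F₂ x happ₂'' V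
  rw [Rule.rename_rename] at hfresh happ₂ hD₂ hs₂ ht₂
  set r₂ := R₂.rename ((ρ₂.trans σ₂).trans σ₃) with hr₂
  have hsource : (r₁.source E₁ D₁ x).toClass CT = (r₂.source E₂ D₂ x).toClass CT := by
    rw [hs₁, hs₁', hs₂, hs₂'', hs₂']
  rw [← ht₁', ← ht₁, ← ht₂', ← ht₂'', ← ht₂]
  by_cases hsat : (r₁.guard ⊓ D₁).Satisfiable CT
  · have hsame := (sameOutcomes_of_toClass_eq hsource).resolve_left fun h => h.1 hsat
    obtain ⟨n, a, b, hm⟩ := hsame.exists_mergedPeak happ₁ happ₂ hfresh (by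
      intro i hi hix hiV
      rw [hx, Finset.mem_union, not_or] at hix
      have h1 := fun h => havoid i h hix.1 (Finset.mem_union_left _ hiV)
      simp only [Finset.mem_union] at h1 hi
      have h2 := fun h => hfresh i h hiV
      have h3 := hD₂ i
      tauto) hsat
    obtain ⟨s, t, I, u, o⟩ := exists_overlap hm.user₁ hm.user₂
    by_cases hcrit : ¬ I.val.map a ≤ r₁.kept ∨ ¬ I.val.map b ≤ r₂.kept
    · exact hm.exists_join_of_critical o (fun S₁ Sc S₂ h =>
        hpeak S₁ Sc S₂ ⟨R₁, hR₁, R₂, hR₂, _, _, h⟩) hcrit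
    · push Not at hcrit
      exact MergedPeak.exists_join_of_not_critical hR₁ hR₂ hr₁ hr₂ hm o hcrit.1 hcrit.2
  · have h2 : ¬ (r₂.guard ⊓ D₂).Satisfiable CT := fun h =>
      (sameOutcomes_of_toClass_eq hsource).elim (fun h' => h'.2 h)
        fun h' => hsat (h'.symm.satisfiable h)
    have key : ∀ (r : Rule 𝓡 𝓒 arity) (D : Constraint 𝓒), ¬ (r.guard ⊓ D).Satisfiable CT →
        ¬ (r.guard ⊓ r.builtinBody ⊓ D).Satisfiable CT := by
      rintro r D h ⟨M, e, he⟩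
      simp only [Constraint.realize_inf] at he
      exact h ⟨M, e, (Constraint.realize_inf _ _ _).2 ⟨he.1.1, he.2⟩⟩
    -- Steps only strengthen the built-in store, so both targets are inconsistent and hence the same
    -- state.
    refine ⟨_, Relation.ReflTransGen.refl, ?_⟩
    have := toClass_of_not_satisfiable (r₂.kept + r₂.body + E₂) (r₁.kept + r₁.body + E₁) _ _ x x
      (key r₂ D₂ h2) (key r₁ D₁ hsat)
    rw [Rule.target, Rule.target, this]
    exact Relation.ReflGen.refl

end CHR

/-! ### Abstract relations: strong commutation and the Hindley–Rosen argument. -/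

section Commutation

variable {α : Type*} {r s : α → α → Prop}

/-- Strongly commuting relations commute. -/
theorem Relation.exists_join_of_strongly_commute
    (h : ∀ a b c, r a b → s a c → ∃ d, ReflTransGen s b d ∧ ReflGen r c d)
    {a b c : α} (hab : ReflTransGen r a b) (hac : ReflTransGen s a c) :
    ∃ d, ReflTransGen s b d ∧ ReflTransGen r c d := by
  -- Because `r` closes the diagram in at most one step, a single `r`-step can be pushed along a
  -- whole `s`-sequence by induction on that sequence.
  have one : ∀ {a b c}, r a b → ReflTransGen s a c → ∃ d, ReflTransGen s b d ∧ ReflGen r c d := by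
    intro a b c hab hac
    induction hac using ReflTransGen.head_induction_on generalizing b with
    | refl => exact ⟨b, ReflTransGen.refl, ReflGen.single hab⟩
    | head hac' hc' ih =>
      obtain ⟨d, hbd, hcd⟩ := h _ _ _ hab hac'
      cases hcd with
      | refl => exact ⟨c, hbd.trans hc', ReflGen.refl⟩
      | single hcd =>
        obtain ⟨d', hd, hd'⟩ := ih hcd
        exact ⟨d', hbd.trans hd, hd'⟩
  induction hab with
  | refl => exact ⟨c, hac, ReflTransGen.refl⟩
  | tail _ hbb' ih =>
    obtain ⟨d, hbd, hcd⟩ := ih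
    obtain ⟨d', hd, hd'⟩ := one hbb' hbd
    exact ⟨d', hd, hcd.trans hd'.to_reflTransGen⟩

/-- The union of two commuting confluent relations is confluent. -/
theorem Relation.exists_join_union
    (hr : ∀ a b c, ReflTransGen r a b → ReflTransGen r a c →
      ∃ d, ReflTransGen r b d ∧ ReflTransGen r c d)
    (hs : ∀ a b c, ReflTransGen s a b → ReflTransGen s a c →
      ∃ d, ReflTransGen s b d ∧ ReflTransGen s c d)
    (hrs : ∀ a b c, ReflTransGen r a b → ReflTransGen s a c →
      ∃ d, ReflTransGen s b d ∧ ReflTransGen r c d)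
    {a b c : α} (hab : ReflTransGen (fun x y => r x y ∨ s x y) a b)
    (hac : ReflTransGen (fun x y => r x y ∨ s x y) a c) :
    ∃ d, ReflTransGen (fun x y => r x y ∨ s x y) b d ∧
      ReflTransGen (fun x y => r x y ∨ s x y) c d := by
  have up : ∀ x y, ReflTransGen (fun x y => r x y ∨ s x y) x y →
      ReflTransGen (fun x y => ReflTransGen r x y ∨ ReflTransGen s x y) x y :=
    fun x y h => by
      refine ReflTransGen.mono (fun _ _ h => ?_) x y h
      exact Or.imp ReflTransGen.single ReflTransGen.single h
  have down : ∀ x y, ReflTransGen (fun x y => ReflTransGen r x y ∨ ReflTransGen s x y) x y →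
      ReflTransGen (fun x y => r x y ∨ s x y) x y := by
    intro x y h
    induction h with
    | refl => exact ReflTransGen.refl
    | tail _ h ih =>
      exact ih.trans (h.elim (ReflTransGen.mono (fun _ _ => Or.inl) _ _)
        (ReflTransGen.mono (fun _ _ => Or.inr) _ _))
  -- The union of the two closures has the diamond property, by confluence in the pure cases and
  -- commutation in the mixed ones, and it generates the same closure as the union of `r` and `s`.
  obtain ⟨d, hbd, hcd⟩ := Relation.church_rosser
    (r := fun x y => ReflTransGen r x y ∨ ReflTransGen s x y) (fun a b c hab hac => by
      rcases hab with hab | hab <;> rcases hac with hac | hac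
      · obtain ⟨d, h1, h2⟩ := hr a b c hab hac
        exact ⟨d, ReflGen.single (Or.inl h1), ReflTransGen.single (Or.inl h2)⟩
      · obtain ⟨d, h1, h2⟩ := hrs a b c hab hac
        exact ⟨d, ReflGen.single (Or.inr h1), ReflTransGen.single (Or.inl h2)⟩
      · obtain ⟨d, h1, h2⟩ := hrs a c b hac hab
        exact ⟨d, ReflGen.single (Or.inl h2), ReflTransGen.single (Or.inr h1)⟩
      · obtain ⟨d, h1, h2⟩ := hs a b c hab hac
        exact ⟨d, ReflGen.single (Or.inr h1), ReflTransGen.single (Or.inr h2)⟩)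
    (up _ _ hab) (up _ _ hac)
  exact ⟨d, down _ _ hbd, down _ _ hcd⟩

end Commutation

theorem CHR.step_union {L : FirstOrder.Language.{u, v}} {CT : L.Theory}
    {𝓒 : ConstraintLanguage L} {Pred : Type w} {arity : Pred → ℕ} {𝓡 : Type*}
    (P Q : Set (Rule 𝓡 𝓒 arity)) :
    Step CT (P ∪ Q) = fun s t => Step CT P s t ∨ Step CT Q s t := by
  funext s t
  refine propext ⟨?_, ?_⟩
  · rintro ⟨r₀, r, ρ, hr₀ | hr₀, hr, E, D, x, hlv⟩
    · exact Or.inl ⟨r₀, r, ρ, hr₀, hr, E, D, x, hlv⟩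
    · exact Or.inr ⟨r₀, r, ρ, hr₀, hr, E, D, x, hlv⟩
  · rintro (⟨r₀, r, ρ, hr₀, hr, E, D, x, hlv⟩ | ⟨r₀, r, ρ, hr₀, hr, E, D, x, hlv⟩)
    · exact ⟨r₀, r, ρ, Or.inl hr₀, hr, E, D, x, hlv⟩
    · exact ⟨r₀, r, ρ, Or.inr hr₀, hr, E, D, x, hlv⟩

theorem mainTheorem2 {L : FirstOrder.Language} (CT : L.Theory)
    (𝓒 : CHR.ConstraintLanguage L) {Pred : Type*} (arity : Pred → ℕ) {𝓡 : Type*}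
    (P Q : Set (CHR.Rule 𝓡 𝓒 arity)) (hP : CHR.IsProgram P) (hQ : CHR.IsProgram Q)
    (hPc : CHR.Confluent CT P) (hQc : CHR.Confluent CT Q)
    (hpeak : ∀ S₁ Sc S₂ : CHR.State 𝓒 arity, CHR.CriticalPeak CT P Q S₁ Sc S₂ →
      ∃ t : CHR.StateClass CT 𝓒 arity,
        CHR.Steps CT Q (S₁.toClass CT) t ∧ CHR.StepEq CT P (S₂.toClass CT) t) :
    CHR.Confluent CT (P ∪ Q) := by
  intro c c₁ c₂ h₁ h₂
  unfold CHR.Steps at h₁ h₂ ⊢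
  rw [CHR.step_union] at h₁ h₂ ⊢
  exact Relation.exists_join_union hPc hQc (fun _ _ _ => Relation.exists_join_of_strongly_commute
    fun _ _ _ => CHR.exists_join_of_step_of_step hpeak) h₁ h₂
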